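/- For a finite simple graph $G$ and $k \ge 0$, let $TS_k(G)$ be the graph whose vertices are the independent sets of $G$ of size $k$, where $I$ and $J$ are adjacent if $J \setminus I = \{u\}$ and $I \setminus J = \{v\}$ for some edge $uv$ of $G$. An interval graph is an intersection graph of closed segments of the real line. Then the following problem can be decided in polynomial time: given an interval graph $G$ (by its adjacency matrix, without an interval representation) and two independent sets $I$ and $J$ of $G$ of the same size $k$ (where $k$ is part of the instance, not a constant), are $I$ and $J$ in the same connected component of $TS_k(G)$? That is, there are a Turing machine and a polynomial $p$ such that, on every such instance, encoded by a binary word of length $N$, the machine halts with the correct answer after at most $p(N)$ steps. -/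

import Mathlib

/-- A graph is an *interval graph* if it is the intersection graph of segments `[l v, r v]`
(with `l v ≤ r v`) of the real line. -/
def SimpleGraph.IsIntervalGraph {V : Type*} (G : SimpleGraph V) : Prop :=
  ∃ l r : V → ℝ, (∀ v, l v ≤ r v) ∧
    ∀ u v, u ≠ v → (G.Adj u v ↔ (Set.Icc (l u) (r u) ∩ Set.Icc (l v) (r v)).Nonempty)

/-- The `k`-TS reconfiguration graph `TS_k(G)`: its vertices are the independent sets of size `k`
of `G`, and `I`, `J` are adjacent if `J \ I = {u}`, `I \ J = {v}` for an edge `uv` of `G`. -/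
def SimpleGraph.tokenSliding {V : Type*} [DecidableEq V] (G : SimpleGraph V) (k : ℕ) :
    SimpleGraph {S : Finset V // G.IsNIndepSet k S} where
  Adj I J := ∃ u v, J.1 \ I.1 = {u} ∧ I.1 \ J.1 = {v} ∧ G.Adj u v
  symm := ⟨by
    rintro I J ⟨u, v, hu, hv, h⟩
    exact ⟨v, u, hv, hu, h.symm⟩⟩
  loopless := ⟨by
    rintro I ⟨u, v, hu, -, -⟩
    simp at hu⟩

/-- An instance of the problem: an interval graph `G` on the vertices `0, …, n - 1` and two
independent sets `I`, `J` of `G` of the same size `k`. -/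
structure TSInstance where
  /-- the number of vertices -/
  n : ℕ
  /-- the graph -/
  G : SimpleGraph (Fin n)
  /-- the number of tokens -/
  k : ℕ
  /-- the first independent set -/
  I : {S : Finset (Fin n) // G.IsNIndepSet k S}
  /-- the second independent set -/
  J : {S : Finset (Fin n) // G.IsNIndepSet k S}
  /-- the graph is an interval graph (no representation is part of the instance) -/
  interval : G.IsIntervalGraph

namespace TSInstance

/-- The characteristic vector of a set of vertices, as a list of `n` bits. -/
def encodeSet {n : ℕ} (S : Finset (Fin n)) : List Bool :=
  (List.finRange n).map fun v => decide (v ∈ S)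

open Classical in
/-- The adjacency matrix of a graph, row by row, as a list of `n * n` bits. -/
noncomputable def encodeGraph {n : ℕ} (G : SimpleGraph (Fin n)) : List Bool :=
  (List.finRange n).flatMap fun u => (List.finRange n).map fun v => decide (G.Adj u v)

/-- The word over `{0, 1}` that is given to the machine: the number `n` of vertices in unary (`n`
ones and a zero), the adjacency matrix of `G`, and the characteristic vectors of `I` and `J`. -/
noncomputable def encode (x : TSInstance) : List Bool :=
  List.replicate x.n true ++ false :: (encodeGraph x.G ++ encodeSet x.I.1 ++ encodeSet x.J.1)

/-- `I` and `J` lie in the same connected component of `TS_k(G)`. -/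
def SameComponent (x : TSInstance) : Prop :=
  (x.G.tokenSliding x.k).connectedComponentMk x.I =
    (x.G.tokenSliding x.k).connectedComponentMk x.J

end TSInstance

/-! Fix an interval representation. The intervals of an independent set are disjoint, hence ordered
from left to right, and a slide along an edge cannot jump over another token. So a configuration is
a chain `Fin k → V` in which every token keeps its index.

The algorithm must not use the representation. It computes the least relation `R a v b x` closed
under rules for pairs of tokens: the token from `a` may slide from `u` to `v` as soon as each other
token, taken separately, has a position compatible with `u` and free of `v`. Reached configurations
satisfy every closed relation (`Conn.mem_of_isClosedRel`). Conversely, the diagonal facts `R a u a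
u` are all realized. `exists_extremal` gives extreme left and right positions `ℓ`, `ρ` of the
tokens; token `i` walks between `ℓ j` for `j < i` and `ρ j` for `j > i`. Every vertex on such a walk
is attained with the other tokens moved aside (`Sweep.conn_hybrid`), and the walks define a closed
relation (`isClosedRel_path`), which contains the least one. Hence `rel_iff_conn`.

Two independent sets are connected iff each token of the first has the same set of possible
positions as some token of the second (`reachable_iff`): equal sets force equal right endpoints of
the leftmost positions, so the matching of tokens preserves the order, and chains with equal right
endpoints are connected.

There are `n ^ 4` tuples, so `n ^ 4` rounds of derivation reach the least closed relation
(`isClosedRel_closure`). The rounds and the final test are bounded loops and first order formulas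
over `{0, …, n - 1}`; such programs compile to stack programs of polynomial running time
(`Prog.runLe_cmd`, `Fm.runLe_cmd`), and these to a machine (`Cmd.polyTime`). -/

namespace TokenSliding

open Relation

variable {V : Type*}

/-! ### Derivation rules for positions of pairs of tokens. -/

/-- Two distinct nonadjacent vertices. -/
def Free (G : SimpleGraph V) (x y : V) : Prop := x ≠ y ∧ ¬ G.Adj x y

/-- One round of the derivation of the facts "the token that starts on `a` can be on `v` while the
token that starts on `b` is on `x`" for the tokens that start on `S`. -/
def TokenStep (G : SimpleGraph V) (S : Finset V) (R : V → V → V → V → Prop) (a v b x : V) : Prop :=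
  (a ∈ S ∧ b ∈ S ∧ v = a ∧ x = b) ∨ R b x a v ∨
    ∃ u, G.Adj u v ∧ (∀ c, c ∈ S → c ≠ a → ∃ y, R a u c y ∧ Free G y v) ∧
      ((a = b ∧ x = v ∧ R a u a u) ∨ (a ≠ b ∧ R a u b x ∧ Free G x v))

/-- A relation closed under the derivation rules. -/
def IsClosedRel (G : SimpleGraph V) (S : Finset V) (R : V → V → V → V → Prop) : Prop :=
  ∀ a v b x, TokenStep G S R a v b x → R a v b x

theorem TokenStep.mono {G : SimpleGraph V} {S : Finset V} {R R' : V → V → V → V → Prop}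
    (h : ∀ a v b x, R a v b x → R' a v b x) {a v b x : V} (hs : TokenStep G S R a v b x) :
    TokenStep G S R' a v b x := by
  rcases hs with hs | hs | ⟨u, hu, hc, hs⟩
  · exact .inl hs
  · exact .inr (.inl (h _ _ _ _ hs))
  · refine .inr (.inr ⟨u, hu, fun c h1 h2 => ?_, ?_⟩)
    · obtain ⟨y, hy, hf⟩ := hc c h1 h2
      exact ⟨y, h _ _ _ _ hy, hf⟩
    · rcases hs with ⟨h1, h2, h3⟩ | ⟨h1, h2, h3⟩
      · exact .inl ⟨h1, h2, h _ _ _ _ h3⟩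
      · exact .inr ⟨h1, h _ _ _ _ h2, h3⟩

/-! ### Interval representations and the left-to-right order. -/

/-- An interval representation of a graph. -/
structure IntervalRep (G : SimpleGraph V) where
  l : V → ℝ
  r : V → ℝ
  le : ∀ v, l v ≤ r v
  adj : ∀ u v, u ≠ v → (G.Adj u v ↔ l u ≤ r v ∧ l v ≤ r u)

theorem exists_rep {G : SimpleGraph V} (h : G.IsIntervalGraph) : Nonempty (IntervalRep G) := by
  obtain ⟨l, r, hle, h⟩ := h
  refine ⟨⟨l, r, hle, fun u v huv => ?_⟩⟩
  rw [h u v huv, Set.Icc_inter_Icc, Set.nonempty_Icc]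
  have h1 := hle u
  have h2 := hle v
  simp only [sup_le_iff, le_inf_iff]
  tauto

namespace IntervalRep

variable {G : SimpleGraph V} (P : IntervalRep G)

/-- The interval of `u` lies to the left of the interval of `v`. -/
def Lt (u v : V) : Prop := P.r u < P.l v

variable {P}

theorem Lt.trans {u v w : V} (h : P.Lt u v) (h' : P.Lt v w) : P.Lt u w := by
  have := P.le v
  unfold Lt at *
  linarith

theorem Lt.asymm {u v : V} (h : P.Lt u v) (h' : P.Lt v u) : False := by
  have := P.le v
  have := P.le u
  unfold Lt at *
  linarith

theorem Lt.free {u v : V} (h : P.Lt u v) : Free G u v := by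
  have h1 : u ≠ v := by
    rintro rfl
    exact h.asymm h
  refine ⟨h1, ?_⟩
  rw [P.adj _ _ h1]
  unfold Lt at h
  rintro ⟨-, h2⟩
  linarith

theorem Lt.free' {u v : V} (h : P.Lt u v) : Free G v u :=
  ⟨h.free.1.symm, fun h' => h.free.2 h'.symm⟩

variable (P) in
theorem lt_or_lt {u v : V} (h : Free G u v) : P.Lt u v ∨ P.Lt v u := by
  have := h.2
  rw [P.adj _ _ h.1] at this
  unfold Lt
  by_contra! hc
  exact this ⟨hc.2, hc.1⟩

/-- Otherwise the interval of `x` would separate those of `v` and `u`, which intersect. This is why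
tokens keep their order. -/
theorem Lt.of_adj_right {x u v : V} (h : P.Lt x u) (ha : G.Adj u v) (hf : Free G x v) :
    P.Lt x v := by
  rcases P.lt_or_lt hf with h' | h'
  · exact h'
  · exact absurd ha.symm (h'.trans h).free.2

theorem Lt.of_adj_left {x u v : V} (h : P.Lt u x) (ha : G.Adj u v) (hf : Free G x v) :
    P.Lt v x := by
  rcases P.lt_or_lt hf with h' | h'
  · exact absurd ha (h.trans h').free.2
  · exact h'

/-! ### Ordered configurations of tokens and their moves. -/

variable (P) {k : ℕ}

/-- The tokens `f 0, …, f (k - 1)` are placed from left to right. -/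
def Chain (f : Fin k → V) : Prop := ∀ i j, i < j → P.Lt (f i) (f j)

/-- Slide one token. -/
def Move (f g : Fin k → V) : Prop :=
  P.Chain f ∧ P.Chain g ∧ ∃ i v, G.Adj (f i) v ∧ g = Function.update f i v

/-- Slide tokens repeatedly. -/
abbrev Conn : (Fin k → V) → (Fin k → V) → Prop := ReflTransGen P.Move

variable {P}

theorem Move.symm {f g : Fin k → V} (h : P.Move f g) : P.Move g f := by
  obtain ⟨hf, hg, i, v, ha, rfl⟩ := h
  exact ⟨hg, hf, i, f i, by simpa using ha.symm, by simp⟩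

theorem Conn.symm {f g : Fin k → V} (h : P.Conn f g) : P.Conn g f :=
  by
  induction h with
  | refl => exact .refl
  | tail _ h ih => exact .head h.symm ih

theorem Conn.chain {f g : Fin k → V} (h : P.Conn f g) (hf : P.Chain f) : P.Chain g := by
  induction h with
  | refl => exact hf
  | tail _ h _ => exact h.2.1

theorem Chain.injective {f : Fin k → V} (h : P.Chain f) : Function.Injective f := by
  intro i j hij
  by_contra hne
  rcases lt_or_gt_of_ne hne with h' | h'
  · exact (h _ _ h').free.1 hij
  · exact (h _ _ h').free.1 hij.symm

theorem Chain.free {f : Fin k → V} (h : P.Chain f) {i j : Fin k} (hij : i ≠ j) :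
    Free G (f i) (f j) := by
  rcases lt_or_gt_of_ne hij with h' | h'
  · exact (h _ _ h').free
  · exact (h _ _ h').free'

theorem Chain.update {f : Fin k → V} (h : P.Chain f) {i : Fin k} {v : V} (hv : G.Adj (f i) v)
    (hf : ∀ j, j ≠ i → Free G (f j) v) : P.Chain (Function.update f i v) := by
  intro p q hpq
  by_cases hp : p = i
  · subst hp
    have hq : q ≠ p := hpq.ne'
    simpa [hq] using (h _ _ hpq).of_adj_left hv (hf q hq)
  · by_cases hq : q = i
    · subst hq
      simpa [hp] using (h _ _ hpq).of_adj_right hv (hf p hp)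
    · simpa [hp, hq] using h _ _ hpq

/-! ### Extreme positions and the walks of single tokens between them. -/

section Extremal

variable (P) (ℓ ρ A : Fin k → V)

/-- The vertices between the left positions of the tokens before `i` and the right positions of
the tokens after `i`. -/
def Gap (i : Fin k) (v : V) : Prop := (∀ j, j < i → P.Lt (ℓ j) v) ∧ ∀ j, i < j → P.Lt v (ρ j)

/-- Token `i` can slide within its gap. -/
abbrev Path (i : Fin k) : V → V → Prop := ReflTransGen fun u v => G.Adj u v ∧ P.Gap ℓ ρ i v

/-- The tokens can be sent, one by one, from the right positions to the left positions. -/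
structure Sweep : Prop where
  gap : ∀ i, P.Gap ℓ ρ i (ℓ i)
  right : ∀ i, P.Path ℓ ρ i (ℓ i) (ρ i)
  start : ∀ i, P.Path ℓ ρ i (ℓ i) (A i)

/-- The first tokens are on their left positions, token `i` is on `x`, the other tokens are on
their right positions. -/
def hybrid (ℓ ρ : Fin k → V) (i : Fin k) (x : V) : Fin k → V :=
  fun j => if j < i then ℓ j else if j = i then x else ρ j

variable {P ℓ ρ A}

theorem Path.gap {i : Fin k} {u v : V} (h : P.Path ℓ ρ i u v) (hu : P.Gap ℓ ρ i u) :
    P.Gap ℓ ρ i v := by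
  induction h with
  | refl => exact hu
  | tail _ h _ => exact h.2

theorem Path.symm {i : Fin k} {u v : V} (h : P.Path ℓ ρ i u v) (hu : P.Gap ℓ ρ i u) :
    P.Path ℓ ρ i v u := by
  induction h with
  | refl => exact .refl
  | tail hp h ih => exact .head ⟨h.1.symm, Path.gap hp hu⟩ ih

/-- The gap of `q` bounds `ℓ q` on the left and the gap of `p` bounds `ρ p` on the right, so both
sides of token `i` are ordered; across `i`, the vertex `x` separates them. -/
theorem Sweep.chain_hybrid (h : P.Sweep ℓ ρ A) {i : Fin k} {x : V} (hx : P.Gap ℓ ρ i x) :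
    P.Chain (hybrid ℓ ρ i x) := by
  intro p q hpq
  unfold hybrid
  rcases lt_trichotomy p i with hp | hp | hp <;> rcases lt_trichotomy q i with hq | hq | hq
  · simpa [hp, hq] using (h.gap q).1 p hpq
  · simpa [hp, hq] using hx.1 p hp
  · simpa [hp, hq.not_gt, hq.ne'] using (hx.1 p hp).trans (hx.2 q hq)
  · omega
  · omega
  · simpa [hp, hq.not_gt, hq.ne'] using hx.2 q hq
  · omega
  · omega
  · simpa [hp.not_gt, hp.ne', hq.not_gt, hq.ne'] using
      ((h.right p).gap (h.gap p)).2 q hpq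

theorem update_hybrid (i : Fin k) (x y : V) :
    Function.update (hybrid ℓ ρ i x) i y = hybrid ℓ ρ i y := by
  funext j
  by_cases hj : j = i
  · subst hj
    simp [hybrid]
  · simp [hybrid, hj]

theorem Sweep.conn_of_path (h : P.Sweep ℓ ρ A) {i : Fin k} {x y : V} (hx : P.Gap ℓ ρ i x)
    (hp : P.Path ℓ ρ i x y) : P.Conn (hybrid ℓ ρ i x) (hybrid ℓ ρ i y) := by
  induction hp with
  | refl => exact .refl
  | @tail y z hp hz ih =>
    refine ih.tail ⟨h.chain_hybrid (Path.gap hp hx), h.chain_hybrid hz.2, i, z, ?_, ?_⟩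
    · simpa [hybrid] using hz.1
    · rw [update_hybrid]

/-- The tokens go from `ρ` to `ℓ` in the order of their indices: when token `t` walks, the earlier
ones are already on the left and the later ones still on the right, which is exactly its gap. -/
theorem Sweep.conn_switch (h : P.Sweep ℓ ρ A) (t : ℕ) (ht : t ≤ k) :
    P.Conn (fun j => if (j : ℕ) < t then ℓ j else ρ j) ℓ := by
  induction ht using Nat.decreasingInduction with
  | self => simpa using ReflTransGen.refl
  | of_succ t ht ih =>
    have key := h.conn_of_path (i := ⟨t, ht⟩) (h.gap _) (h.right _)
    refine .trans ?_ ih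
    convert key.symm using 1
    · funext j
      simp only [hybrid, Fin.lt_def, Fin.ext_iff]
      split_ifs with h1 h2
      · rfl
      · congr 1
        exact Fin.ext h2
      · rfl
    · funext j
      by_cases hj : j = ⟨t, ht⟩
      · subst hj
        simp [hybrid]
      · have : (j : ℕ) ≠ t := fun h => hj (Fin.ext h)
        simp only [hybrid, Fin.lt_def, hj, if_false]
        split_ifs <;> first | rfl | omega

theorem Sweep.conn_hybrid (h : P.Sweep ℓ ρ A) {i : Fin k} {x : V} (hx : P.Path ℓ ρ i (ℓ i) x) :
    P.Conn (hybrid ℓ ρ i x) ℓ := by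
  refine .trans (h.conn_of_path (h.gap i) hx).symm (.trans ?_ (h.conn_switch (i + 1) i.2))
  convert ReflTransGen.refl using 1
  funext j
  simp only [hybrid, Fin.lt_def, Fin.ext_iff]
  split_ifs with h1 h2 h3 h4 <;> first | rfl | omega | skip
  congr 1
  exact Fin.ext h3

theorem Gap.update {i j : Fin k} {v x y : V} (h : P.Gap ℓ ρ j v) (hx : P.r x ≤ P.r (ℓ i))
    (hy : P.l (ρ i) ≤ P.l y) :
    P.Gap (Function.update ℓ i x) (Function.update ρ i y) j v := by
  constructor
  · intro p hp
    have := h.1 p hp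
    by_cases hpi : p = i
    · subst hpi
      simpa [Lt] using lt_of_le_of_lt hx this
    · simpa [hpi] using this
  · intro p hp
    have := h.2 p hp
    by_cases hpi : p = i
    · subst hpi
      simpa [Lt] using lt_of_lt_of_le this hy
    · simpa [hpi] using this

theorem Path.update {i j : Fin k} {u v x y : V} (h : P.Path ℓ ρ j u v) (hx : P.r x ≤ P.r (ℓ i))
    (hy : P.l (ρ i) ≤ P.l y) :
    P.Path (Function.update ℓ i x) (Function.update ρ i y) j u v :=
  ReflTransGen.mono (fun _ _ h => ⟨h.1, h.2.update hx hy⟩) _ _ h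

/-- The gap of `i` does not involve `ℓ i` and `ρ i`, and pushing these outwards only widens the
other gaps. -/
theorem Sweep.update (h : P.Sweep ℓ ρ A) {i : Fin k} {x y : V} (hpx : P.Path ℓ ρ i (ℓ i) x)
    (hpy : P.Path ℓ ρ i (ℓ i) y) (hx : P.r x ≤ P.r (ℓ i)) (hy : P.l (ρ i) ≤ P.l y) :
    P.Sweep (Function.update ℓ i x) (Function.update ρ i y) A := by
  refine ⟨fun j => ?_, fun j => ?_, fun j => ?_⟩
  · by_cases hj : j = i
    · subst hj
      simpa using (hpx.gap (h.gap _)).update hx hy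
    · simpa [hj] using (h.gap j).update hx hy
  · by_cases hj : j = i
    · subst hj
      simpa using Path.update ((Path.symm hpx (h.gap _)).trans hpy) hx hy
    · simpa [hj] using (h.right j).update hx hy
  · by_cases hj : j = i
    · subst hj
      simpa using Path.update ((Path.symm hpx (h.gap _)).trans (h.start _)) hx hy
    · simpa [hj] using (h.start j).update hx hy

/-- The configuration `hybrid ℓ ρ i x` belongs to both the old and the new sweep, because it uses
neither `ℓ i` nor `ρ i`. The two sweeps take it to the two left configurations. -/
theorem Sweep.conn_update (h : P.Sweep ℓ ρ A) {i : Fin k} {x y : V} (hpx : P.Path ℓ ρ i (ℓ i) x)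
    (hpy : P.Path ℓ ρ i (ℓ i) y) (hx : P.r x ≤ P.r (ℓ i)) (hy : P.l (ρ i) ≤ P.l y) :
    P.Conn ℓ (Function.update ℓ i x) := by
  have h1 := h.conn_hybrid hpx
  have h2 := (h.update hpx hpy hx hy).conn_hybrid (i := i) (x := x)
    (by simpa using ReflTransGen.refl)
  have : hybrid (Function.update ℓ i x) (Function.update ρ i y) i x = hybrid ℓ ρ i x := by
    funext j
    unfold hybrid
    by_cases hj : j = i
    · simp [hj]
    · simp [hj]
  rw [this] at h2
  exact .trans h1.symm h2

/-- Among the finitely many sweeps whose left configuration is reachable from `A`, take one that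
minimizes the sum of the right endpoints of `ℓ` minus the sum of the left endpoints of `ρ`. A walk
that went further out would give a better sweep by `Sweep.update`. -/
theorem exists_extremal [Finite V] (hA : P.Chain A) :
    ∃ ℓ ρ : Fin k → V, P.Sweep ℓ ρ A ∧ P.Conn A ℓ ∧
      ∀ i v, P.Path ℓ ρ i (ℓ i) v → P.r (ℓ i) ≤ P.r v ∧ P.l v ≤ P.l (ρ i) := by
  let T : Set ((Fin k → V) × (Fin k → V)) := {q | P.Sweep q.1 q.2 A ∧ P.Conn A q.1}
  have hT : T.Nonempty :=
    ⟨(A, A), ⟨fun i => ⟨fun j hj => hA _ _ hj, fun j hj => hA _ _ hj⟩, fun i => .refl,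
      fun i => .refl⟩, .refl⟩
  obtain ⟨⟨ℓ, ρ⟩, ⟨h1, h2⟩, hmin⟩ := Set.exists_min_image T
    (fun q => ∑ i, P.r (q.1 i) - ∑ i, P.l (q.2 i)) (Set.toFinite T) hT
  dsimp only at h1 h2 hmin
  refine ⟨ℓ, ρ, h1, h2, fun i v hv => ?_⟩
  have key : ∀ (f : Fin k → V) (F : V → ℝ) (w : V),
      ∑ j, F (Function.update f i w j) = ∑ j, F (f j) + (F w - F (f i)) := by
    intro f F w
    have : ∀ j, F (Function.update f i w j) = F (f j) + if j = i then F w - F (f i) else 0 := by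
      intro j
      by_cases hj : j = i
      · subst hj
        simp
      · simp [hj]
    simp [this, Finset.sum_add_distrib]
  constructor
  · by_contra! hc
    have := hmin (Function.update ℓ i v, Function.update ρ i (ρ i))
      ⟨h1.update hv (h1.right i) hc.le le_rfl,
        h2.trans (h1.conn_update hv (h1.right i) hc.le le_rfl)⟩
    dsimp only at this
    rw [key, key] at this
    linarith
  · by_contra! hc
    have := hmin (Function.update ℓ i (ℓ i), Function.update ρ i v)
      ⟨h1.update .refl hv le_rfl hc.le, h2.trans (h1.conn_update .refl hv le_rfl hc.le)⟩
    dsimp only at this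
    rw [key, key] at this
    linarith

/-- When token `i` slides to `v`, each earlier token `j` lies left of `v`; by extremality `ℓ j` ends
no later than that token, so `ℓ j` lies left of `v` too. The right side is symmetric, so `v` is in
the gap. -/
theorem Conn.path {f : Fin k → V} (hs : P.Sweep ℓ ρ A)
    (hext : ∀ i v, P.Path ℓ ρ i (ℓ i) v → P.r (ℓ i) ≤ P.r v ∧ P.l v ≤ P.l (ρ i))
    (h : P.Conn A f) (i : Fin k) : P.Path ℓ ρ i (ℓ i) (f i) := by
  induction h generalizing i with
  | refl => exact hs.start i
  | @tail f g _ hm ih =>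
    obtain ⟨-, hg, p, v, ha, rfl⟩ := hm
    by_cases hi : i = p
    · subst hi
      refine (ih i).tail ⟨by simpa using ha, ?_, ?_⟩
      · intro j hj
        have h1 := hg j i hj
        simp only [Function.update_self, Function.update_of_ne hj.ne] at h1 ⊢
        exact lt_of_le_of_lt (hext _ _ (ih j)).1 h1
      · intro j hj
        have h1 := hg i j hj
        simp only [Function.update_self, Function.update_of_ne hj.ne'] at h1 ⊢
        exact lt_of_lt_of_le h1 (hext _ _ (ih j)).2
    · simpa [hi] using ih i

/-- The positions that are not excluded by the extremal positions form a closed relation. -/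
theorem isClosedRel_path [DecidableEq V] (hA : P.Chain A) (hs : P.Sweep ℓ ρ A)
    (hext : ∀ i v, P.Path ℓ ρ i (ℓ i) v → P.r (ℓ i) ≤ P.r v ∧ P.l v ≤ P.l (ρ i)) :
    IsClosedRel G (Finset.univ.image A) fun a u b x => ∃ i j, a = A i ∧ b = A j ∧
      P.Path ℓ ρ i (ℓ i) u ∧ P.Path ℓ ρ j (ℓ j) x ∧
      (i < j → P.Lt u x) ∧ (j < i → P.Lt x u) ∧ (i = j → u = x) := by
  -- The witnesses `y` for different tokens need not fit together. Each one alone stays on its side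
  -- of `v`, and by extremality `ℓ p` or `ρ p` is at least as far out; these are already mutually
  -- compatible. This is why rules for pairs suffice.
  have step : ∀ (i : Fin k) (u v : V), P.Path ℓ ρ i (ℓ i) u → G.Adj u v →
      (∀ c, c ∈ Finset.univ.image A → c ≠ A i → ∃ y, (∃ i' j, A i = A i' ∧ c = A j ∧
      P.Path ℓ ρ i' (ℓ i') u ∧ P.Path ℓ ρ j (ℓ j) y ∧
      (i' < j → P.Lt u y) ∧ (j < i' → P.Lt y u) ∧ (i' = j → u = y)) ∧ Free G y v) →
      P.Path ℓ ρ i (ℓ i) v := by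
    intro i u v hu ha hc
    have key : ∀ p, p ≠ i → ∃ y, P.Path ℓ ρ p (ℓ p) y ∧ (i < p → P.Lt u y) ∧
        (p < i → P.Lt y u) ∧ Free G y v := by
      intro p hp
      obtain ⟨y, ⟨i', j, h1, h2, -, h3, h4, h5, -⟩, hf⟩ :=
        hc (A p) (by simp) (fun h => hp (hA.injective h))
      obtain rfl := hA.injective h1
      obtain rfl := hA.injective h2
      exact ⟨y, h3, h4, h5, hf⟩
    refine hu.tail ⟨ha, fun p hp => ?_, fun p hp => ?_⟩
    · obtain ⟨y, h1, -, h2, hf⟩ := key p hp.ne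
      exact lt_of_le_of_lt (hext _ _ h1).1 ((h2 hp).of_adj_right ha hf)
    · obtain ⟨y, h1, h2, -, hf⟩ := key p hp.ne'
      exact lt_of_lt_of_le ((h2 hp).of_adj_left ha hf) (hext _ _ h1).2
  rintro a v b x (⟨ha, hb, rfl, rfl⟩ | ⟨i, j, rfl, rfl, h1, h2, h3, h4, h5⟩ |
    ⟨u, hu, hc, ⟨rfl, rfl, i, j, rfl, h0, h1, h2, -⟩ |
      ⟨hab, ⟨i, j, rfl, rfl, h1, h2, h3, h4, h5⟩, hf⟩⟩)
  · obtain ⟨i, -, rfl⟩ := Finset.mem_image.1 ha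
    obtain ⟨j, -, rfl⟩ := Finset.mem_image.1 hb
    exact ⟨i, j, rfl, rfl, hs.start i, hs.start j, hA i j, hA j i, fun h => by rw [h]⟩
  · exact ⟨j, i, rfl, rfl, h2, h1, h4, h3, fun h => (h5 h.symm).symm⟩
  · have := step i u x h1 hu hc
    exact ⟨i, i, rfl, rfl, this, this, fun h => absurd h (lt_irrefl _),
      fun h => absurd h (lt_irrefl _), fun _ => rfl⟩
  · refine ⟨i, j, rfl, rfl, step i u v h1 hu hc, h2, fun h => (h3 h).of_adj_left hu hf,
      fun h => (h4 h).of_adj_right hu hf, fun h => absurd (by rw [h]) hab⟩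

end Extremal

/-! ### Reached configurations satisfy the derivation rules. -/

theorem Conn.mem_of_isClosedRel [DecidableEq V] {A f : Fin k → V}
    {R : V → V → V → V → Prop} (hR : IsClosedRel G (Finset.univ.image A) R) (hA : P.Chain A)
    (h : P.Conn A f) (i j : Fin k) : R (A i) (f i) (A j) (f j) := by
  induction h generalizing i j with
  | refl => exact hR _ _ _ _ (.inl ⟨by simp, by simp, rfl, rfl⟩)
  | @tail f g _ hm ih =>
    obtain ⟨hf, hg, p, v, ha, rfl⟩ := hm
    have hfree : ∀ q, q ≠ p → Free G (f q) v := by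
      intro q hq
      simpa [hq] using hg.free hq
    have hsup : ∀ c, c ∈ Finset.univ.image A → c ≠ A p → ∃ y, R (A p) (f p) c y ∧ Free G y v := by
      intro c hc hcp
      obtain ⟨q, -, rfl⟩ := Finset.mem_image.1 hc
      exact ⟨f q, ih p q, hfree q fun h => hcp (by rw [h])⟩
    have hmove : ∀ q, q ≠ p → R (A p) v (A q) (f q) := fun q hq =>
      hR _ _ _ _ (.inr (.inr ⟨f p, ha, hsup,
        .inr ⟨fun h => hq (hA.injective h).symm, ih p q, hfree q hq⟩⟩))
    by_cases hi : i = p <;> by_cases hj : j = p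
    · subst hi
      subst hj
      simpa using hR _ _ _ _ (.inr (.inr ⟨f j, ha, hsup, .inl ⟨rfl, rfl, ih j j⟩⟩))
    · subst hi
      simpa [hj] using hmove j hj
    · subst hj
      simpa [hi] using hR _ _ _ _ (.inr (.inl (hmove i hi)))
    · simpa [hi, hj] using ih i j

/-! ### Chains versus vertices of the token sliding graph. -/

section TokenGraph

variable [DecidableEq V]

theorem Chain.isNIndepSet {f : Fin k → V} (h : P.Chain f) :
    G.IsNIndepSet k (Finset.univ.image f) := by
  constructor
  · intro x hx y hy hxy
    simp only [Finset.coe_image, Finset.coe_univ, Set.image_univ, Set.mem_range] at hx hy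
    obtain ⟨i, rfl⟩ := hx
    obtain ⟨j, rfl⟩ := hy
    exact (h.free fun hij => hxy (by rw [hij])).2
  · rw [Finset.card_image_of_injective _ h.injective]
    simp

theorem Move.adj {f g : Fin k → V} (h : P.Move f g) :
    (G.tokenSliding k).Adj ⟨_, h.1.isNIndepSet⟩ ⟨_, h.2.1.isNIndepSet⟩ := by
  obtain ⟨hf, hg, i, v, ha, rfl⟩ := h
  refine ⟨v, f i, ?_, ?_, ha.symm⟩
  · ext w
    simp only [Finset.mem_sdiff, Finset.mem_image, Finset.mem_univ, true_and, not_exists,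
      Finset.mem_singleton]
    constructor
    · rintro ⟨⟨j, rfl⟩, hj⟩
      by_cases hji : j = i
      · simp [hji]
      · simp only [Function.update_of_ne hji] at hj
        exact absurd rfl (hj j)
    · rintro rfl
      refine ⟨⟨i, by simp⟩, fun j hj => ?_⟩
      by_cases hji : j = i
      · subst hji
        exact ha.ne hj
      · have := hg.free hji
        simp only [Function.update_of_ne hji, Function.update_self] at this
        exact this.1 hj
  · ext w
    simp only [Finset.mem_sdiff, Finset.mem_image, Finset.mem_univ, true_and, not_exists,
      Finset.mem_singleton]
    constructor
    · rintro ⟨⟨j, rfl⟩, hj⟩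
      by_cases hji : j = i
      · rw [hji]
      · exact absurd (by simp [hji]) (hj j)
    · rintro rfl
      refine ⟨⟨i, rfl⟩, fun j hj => ?_⟩
      by_cases hji : j = i
      · subst hji
        simp only [Function.update_self] at hj
        exact ha.ne hj.symm
      · simp only [Function.update_of_ne hji] at hj
        exact hji (hf.injective hj)

theorem Conn.reachable {f g : Fin k → V} (h : P.Conn f g) (hf : P.Chain f) (hg : P.Chain g) :
    (G.tokenSliding k).Reachable ⟨_, hf.isNIndepSet⟩ ⟨_, hg.isNIndepSet⟩ := by
  induction h with
  | refl => exact .refl _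
  | @tail f' g' _ hm ih => exact (ih hm.1).trans hm.adj.reachable

theorem exists_move_of_adj {I J : {S : Finset V // G.IsNIndepSet k S}} {f : Fin k → V}
    (hf : P.Chain f) (hI : Finset.univ.image f = I.1) (h : (G.tokenSliding k).Adj I J) :
    ∃ g, P.Move f g ∧ Finset.univ.image g = J.1 := by
  obtain ⟨u, v, hu, hv, ha⟩ := h
  have hvI : v ∈ I.1 \ J.1 := by simp [hv]
  have huJ : u ∈ J.1 \ I.1 := by simp [hu]
  rw [Finset.mem_sdiff] at hvI huJ
  have hvI' := hvI.1
  rw [← hI] at hvI'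
  obtain ⟨i, -, rfl⟩ := Finset.mem_image.1 hvI'
  have hJ : ∀ j, j ≠ i → f j ∈ J.1 := by
    intro j hj
    by_contra hc
    have : f j ∈ I.1 \ J.1 := Finset.mem_sdiff.2 ⟨hI ▸ Finset.mem_image_of_mem _ (Finset.mem_univ _), hc⟩
    rw [hv, Finset.mem_singleton] at this
    exact hj (hf.injective this)
  have hne : ∀ j, f j ≠ u := by
    rintro j rfl
    exact huJ.2 (hI ▸ Finset.mem_image_of_mem _ (Finset.mem_univ _))
  have hg : P.Chain (Function.update f i u) :=
    hf.update ha.symm fun j hj => ⟨hne j, J.2.1 (hJ j hj) huJ.1 (hne j)⟩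
  refine ⟨_, ⟨hf, hg, i, u, ha.symm, rfl⟩, ?_⟩
  refine Finset.eq_of_subset_of_card_le ?_ ?_
  · intro w hw
    obtain ⟨j, -, rfl⟩ := Finset.mem_image.1 hw
    by_cases hj : j = i
    · subst hj
      simpa using huJ.1
    · simpa [hj] using hJ j hj
  · rw [J.2.2, hg.isNIndepSet.2]

theorem exists_conn_of_reachable {I J : {S : Finset V // G.IsNIndepSet k S}} {f : Fin k → V}
    (hf : P.Chain f) (hI : Finset.univ.image f = I.1) (h : (G.tokenSliding k).Reachable I J) :
    ∃ g, P.Conn f g ∧ Finset.univ.image g = J.1 := by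
  rw [SimpleGraph.reachable_iff_reflTransGen] at h
  induction h with
  | refl => exact ⟨f, .refl, hI⟩
  | tail _ h ih =>
    obtain ⟨g, hg, hgI⟩ := ih
    obtain ⟨g', hm, hg'⟩ := exists_move_of_adj (hg.chain hf) hgI h
    exact ⟨g', hg.tail hm, hg'⟩

variable (P) in
-- Disjoint segments have distinct left endpoints; sorting by these orders the tokens.
theorem exists_chain {I : Finset V} (hI : G.IsNIndepSet k I) :
    ∃ f : Fin k → V, P.Chain f ∧ Finset.univ.image f = I := by
  have hfree : ∀ x ∈ I, ∀ y ∈ I, x ≠ y → P.Lt x y ∨ P.Lt y x := fun x hx y hy hxy =>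
    P.lt_or_lt ⟨hxy, hI.1 hx hy hxy⟩
  have hinj : Set.InjOn P.l I := by
    intro x hx y hy hxy
    by_contra hne
    have h1 := P.le x
    have h2 := P.le y
    rcases hfree x hx y hy hne with h | h <;> unfold Lt at h <;> linarith
  have hcard : (I.image P.l).card = k := by rw [Finset.card_image_of_injOn hinj, hI.2]
  have hmem : ∀ i : Fin k, ∃ x ∈ I, P.l x = (I.image P.l).orderEmbOfFin hcard i := fun i =>
    Finset.mem_image.1 (Finset.orderEmbOfFin_mem _ hcard i)
  choose f hf hfl using hmem
  have hch : P.Chain f := by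
    intro i j hij
    have h1 : P.l (f i) < P.l (f j) := by
      rw [hfl, hfl]
      exact (OrderEmbedding.lt_iff_lt _).2 hij
    rcases hfree _ (hf i) _ (hf j) (fun h => by rw [h] at h1; exact lt_irrefl _ h1) with h | h
    · exact h
    · have := P.le (f j)
      unfold Lt at h
      linarith
  refine ⟨f, hch, Finset.eq_of_subset_of_card_le ?_ ?_⟩
  · intro w hw
    obtain ⟨j, -, rfl⟩ := Finset.mem_image.1 hw
    exact hf j
  · rw [hI.2, hch.isNIndepSet.2]

end TokenGraph

/-! ### Characterization of the components by the possible positions of tokens. -/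

theorem rel_iff_conn [DecidableEq V] [Finite V] {A : Fin k → V} (hA : P.Chain A)
    {R : V → V → V → V → Prop} (hR : IsClosedRel G (Finset.univ.image A) R)
    (hmin : ∀ R', IsClosedRel G (Finset.univ.image A) R' → ∀ a v b x, R a v b x → R' a v b x)
    (i : Fin k) (u : V) : R (A i) u (A i) u ↔ ∃ f, P.Conn A f ∧ f i = u := by
  constructor
  · intro h
    obtain ⟨ℓ, ρ, hs, hc, hext⟩ := exists_extremal hA
    obtain ⟨i', j, h1, -, h2, -⟩ := hmin _ (isClosedRel_path hA hs hext) _ _ _ _ h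
    obtain rfl := hA.injective h1
    exact ⟨_, hc.trans (hs.conn_hybrid h2).symm, by simp [hybrid]⟩
  · rintro ⟨f, hf, rfl⟩
    exact Conn.mem_of_isClosedRel hR hA hf i i

/-- The chain of the leftmost positions of the tokens. -/
theorem exists_leftmost [Finite V] {A : Fin k → V} (hA : P.Chain A) :
    ∃ ℓ : Fin k → V, P.Conn A ℓ ∧ ∀ f, P.Conn A f → ∀ i, P.r (ℓ i) ≤ P.r (f i) := by
  obtain ⟨ℓ, ρ, hs, hc, hext⟩ := exists_extremal hA
  exact ⟨ℓ, hc, fun f hf i => (hext _ _ (hf.path hs hext i)).1⟩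

/-- Tokens are switched from `f` to `g` in the order of their indices. A switched token keeps its
right endpoint, so it still lies left of the later ones, and two segments with a common right
endpoint are equal as vertices or adjacent. -/
theorem conn_of_right_eq {f g : Fin k → V} (hf : P.Chain f) (hg : P.Chain g)
    (h : ∀ i, P.r (f i) = P.r (g i)) : P.Conn f g := by
  let F : ℕ → Fin k → V := fun t j => if (j : ℕ) < t then g j else f j
  have hF : ∀ t, P.Chain (F t) := by
    intro t i j hij
    have h1 := hf i j hij
    have h2 := hg i j hij
    unfold Lt at *
    simp only [F]
    split_ifs <;> [exact h2; (rw [← h i]; exact h1); (rw [h i]; exact h2); exact h1]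
  have key : ∀ t ≤ k, P.Conn f (F t) := by
    intro t ht
    induction t with
    | zero => simpa [F] using ReflTransGen.refl
    | succ t ih =>
      refine (ih (by omega)).trans ?_
      let i : Fin k := ⟨t, ht⟩
      have hup : F (t + 1) = Function.update (F t) i (g i) := by
        funext j
        by_cases hj : j = i
        · subst hj
          simp [F, i]
        · have : (j : ℕ) ≠ t := fun h => hj (Fin.ext h)
          rw [Function.update_of_ne hj]
          simp only [F]
          split_ifs <;> first | rfl | omega
      have hi : F t i = f i := by simp [F, i]
      by_cases hfg : f i = g i
      · rw [hup, ← hfg, ← hi, Function.update_eq_self]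
      · refine .single ⟨hF _, hF _, i, g i, ?_, hup⟩
        rw [hi, P.adj _ _ hfg]
        have h1 := P.le (f i)
        have h2 := P.le (g i)
        have h3 := h i
        constructor <;> linarith
  have := key k le_rfl
  simpa [F] using this

end IntervalRep

theorem fin_strictMono_eq {k : ℕ} {φ : Fin k → Fin k} (h : StrictMono φ) (i : Fin k) : φ i = i := by
  have h1 : (OrderEmbedding.ofStrictMono φ h : Fin k → Fin k) = id := by
    apply StrictMono.range_inj (β := Fin k) h strictMono_id |>.1
    rw [Set.range_id, (Finite.injective_iff_surjective.1 h.injective).range_eq]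
  exact congrFun h1 i

open IntervalRep in
/-- Two independent sets are in the same component of the token sliding graph of an interval graph
if and only if their tokens have the same sets of possible positions. -/
theorem reachable_iff [DecidableEq V] [Finite V] {G : SimpleGraph V} (hG : G.IsIntervalGraph)
    {k : ℕ} (I J : {S : Finset V // G.IsNIndepSet k S}) {R R' : V → V → V → V → Prop}
    (hR : IsClosedRel G I.1 R)
    (hmin : ∀ R₁, IsClosedRel G I.1 R₁ → ∀ a v b x, R a v b x → R₁ a v b x)
    (hR' : IsClosedRel G J.1 R')
    (hmin' : ∀ R₁, IsClosedRel G J.1 R₁ → ∀ a v b x, R' a v b x → R₁ a v b x) :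
    (G.tokenSliding k).Reachable I J ↔
      ∀ a ∈ I.1, ∃ b ∈ J.1, ∀ u, R a u a u ↔ R' b u b u := by
  obtain ⟨P⟩ := exists_rep hG
  obtain ⟨A, hA, hAI⟩ := P.exists_chain I.2
  have hRA := fun i u => rel_iff_conn hA (by rwa [hAI]) (by rwa [hAI]) i u (R := R)
  constructor
  · intro h
    obtain ⟨B, hAB, hBJ⟩ := exists_conn_of_reachable hA hAI h
    have hB := hAB.chain hA
    have hRB := fun i u => rel_iff_conn hB (by rwa [hBJ]) (by rwa [hBJ]) i u (R := R')
    rw [← hAI, ← hBJ]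
    intro a ha
    obtain ⟨i, -, rfl⟩ := Finset.mem_image.1 ha
    refine ⟨B i, Finset.mem_image_of_mem _ (Finset.mem_univ _), fun u => ?_⟩
    rw [hRA, hRB]
    exact ⟨fun ⟨f, h1, h2⟩ => ⟨f, hAB.symm.trans h1, h2⟩, fun ⟨f, h1, h2⟩ => ⟨f, hAB.trans h1, h2⟩⟩
  · obtain ⟨B, hB, hBJ⟩ := P.exists_chain J.2
    have hRB := fun i u => rel_iff_conn hB (by rwa [hBJ]) (by rwa [hBJ]) i u (R := R')
    intro h
    have h' : ∀ i, ∃ j, ∀ u, R (A i) u (A i) u ↔ R' (B j) u (B j) u := by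
      intro i
      obtain ⟨b, hb, hbu⟩ := h (A i) (by simp [← hAI])
      rw [← hBJ] at hb
      obtain ⟨j, -, rfl⟩ := Finset.mem_image.1 hb
      exact ⟨j, hbu⟩
    choose φ hφ using h'
    obtain ⟨ℓ, hℓ, hℓmin⟩ := exists_leftmost hA
    obtain ⟨m, hm, hmmin⟩ := exists_leftmost hB
    have hcℓ := hℓ.chain hA
    have hcm := hm.chain hB
    -- The leftmost position on one side is a possible position of the matched token on the other
    -- side, so neither right endpoint exceeds the other.
    have heq : ∀ i, P.r (ℓ i) = P.r (m (φ i)) := by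
      intro i
      apply le_antisymm
      · obtain ⟨f, hf, hfi⟩ := (hRA i (m (φ i))).1 ((hφ i _).2 ((hRB _ _).2 ⟨m, hm, rfl⟩))
        rw [← hfi]
        exact hℓmin f hf i
      · obtain ⟨f, hf, hfi⟩ := (hRB (φ i) (ℓ i)).1 ((hφ i _).1 ((hRA _ _).2 ⟨ℓ, hℓ, rfl⟩))
        rw [← hfi]
        exact hmmin f hf (φ i)
    have hmono : ∀ f : Fin k → V, P.Chain f → StrictMono fun i => P.r (f i) := fun f hf i j hij =>
      lt_of_lt_of_le (hf i j hij) (P.le _)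
    have hφmono : StrictMono φ := by
      intro i j hij
      have := hmono ℓ hcℓ hij
      simp only [heq] at this
      exact (hmono m hcm).lt_iff_lt.1 this
    have hconn : P.Conn A B := by
      refine hℓ.trans (.trans ?_ hm.symm)
      refine conn_of_right_eq hcℓ hcm fun i => ?_
      rw [heq, fin_strictMono_eq hφmono]
    have := hconn.reachable hA hB
    convert this using 1 <;> exact Subtype.ext (by simp [hAI, hBJ])

end TokenSliding

/-! ### Structured stack programs and their compilation to machines. -/

namespace StackProgram

open Turing

/-- Structured programs over a family of stacks of bits. -/
inductive Cmd (K : Type) : Type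
  /-- do nothing -/
  | skip : Cmd K
  /-- push a bit on a stack -/
  | push (k : K) (b : Bool) : Cmd K
  /-- sequential composition -/
  | seq (c d : Cmd K) : Cmd K
  /-- pop a stack and branch: empty stack, `false`, `true` -/
  | case (k : K) (c₀ c₁ c₂ : Cmd K) : Cmd K
  /-- pop a stack until it is empty, and run the first program for each `false` and the second one
  for each `true` -/
  | loop (k : K) (c d : Cmd K) : Cmd K
  /-- pop a stack, and run the program for each `true`, until the stack is empty or a `false` is
  popped -/
  | whileTrue (k : K) (c : Cmd K) : Cmd K

namespace Cmd

variable {K : Type}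

/-- The program points. -/
def Pos : Cmd K → Type
  | skip => Unit
  | push _ _ => Unit
  | seq c d => Pos c ⊕ Pos d
  | case _ a b c => Unit ⊕ (Pos a ⊕ (Pos b ⊕ Pos c))
  | loop _ c d => Unit ⊕ (Pos c ⊕ Pos d)
  | whileTrue _ c => Unit ⊕ Pos c

/-- There are finitely many program points. -/
instance posFintype : ∀ c : Cmd K, Fintype (Pos c)
  | skip => inferInstanceAs (Fintype Unit)
  | push _ _ => inferInstanceAs (Fintype Unit)
  | seq c d =>
    have := posFintype c
    have := posFintype d
    inferInstanceAs (Fintype (Pos c ⊕ Pos d))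
  | case _ a b c =>
    have := posFintype a
    have := posFintype b
    have := posFintype c
    inferInstanceAs (Fintype (Unit ⊕ (Pos a ⊕ (Pos b ⊕ Pos c))))
  | loop _ c d =>
    have := posFintype c
    have := posFintype d
    inferInstanceAs (Fintype (Unit ⊕ (Pos c ⊕ Pos d)))
  | whileTrue _ c =>
    have := posFintype c
    inferInstanceAs (Fintype (Unit ⊕ Pos c))

/-- The first program point. -/
def entry : ∀ c : Cmd K, Pos c
  | skip => ()
  | push _ _ => ()
  | seq c _ => Sum.inl (entry c)
  | case _ _ _ _ => Sum.inl ()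
  | loop _ _ _ => Sum.inl ()
  | whileTrue _ _ => Sum.inl ()

/-- Pop a stack into the internal state and jump. -/
def popGoto {Λ : Type} (k : K) (x y z : Λ) : TM2.Stmt (fun _ : K => Bool) Λ (Option Bool) :=
  .pop k (fun _ o => o) (.goto fun v => match v with
    | none => x
    | some false => y
    | some true => z)

/-- The statements of the stack machine at the program points, which jump to `ex` at the end. -/
def code {Λ : Type} : ∀ c : Cmd K, (Pos c → Λ) → Λ → Pos c →
    TM2.Stmt (fun _ : K => Bool) Λ (Option Bool)
  | skip, _, ex, _ => .goto fun _ => ex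
  | push k b, _, ex, _ => .push k (fun _ => b) (.goto fun _ => ex)
  | seq c d, e, _, Sum.inl p => code c (fun p => e (.inl p)) (e (.inr (entry d))) p
  | seq _ d, e, ex, Sum.inr p => code d (fun p => e (.inr p)) ex p
  | case k a b c, e, _, Sum.inl _ => popGoto k (e (.inr (.inl (entry a))))
      (e (.inr (.inr (.inl (entry b))))) (e (.inr (.inr (.inr (entry c)))))
  | case _ a _ _, e, ex, Sum.inr (Sum.inl p) => code a (fun p => e (.inr (.inl p))) ex p
  | case _ _ b _, e, ex, Sum.inr (Sum.inr (Sum.inl p)) =>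
      code b (fun p => e (.inr (.inr (.inl p)))) ex p
  | case _ _ _ c, e, ex, Sum.inr (Sum.inr (Sum.inr p)) =>
      code c (fun p => e (.inr (.inr (.inr p)))) ex p
  | loop k c d, e, ex, Sum.inl _ => popGoto k ex (e (.inr (.inl (entry c))))
      (e (.inr (.inr (entry d))))
  | loop _ c _, e, _, Sum.inr (Sum.inl p) => code c (fun p => e (.inr (.inl p))) (e (.inl ())) p
  | loop _ _ d, e, _, Sum.inr (Sum.inr p) => code d (fun p => e (.inr (.inr p))) (e (.inl ())) p
  | whileTrue k c, e, ex, Sum.inl _ => popGoto k ex ex (e (.inr (entry c)))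
  | whileTrue _ c, e, _, Sum.inr p => code c (fun p => e (.inr p)) (e (.inl ())) p

variable [DecidableEq K]

/-- `Run c s t s'`: from the stacks `s` the program `c` ends after `t` steps with the stacks
`s'`. -/
inductive Run : Cmd K → (K → List Bool) → ℕ → (K → List Bool) → Prop
  | skip (s) : Run skip s 1 s
  | push (k b s) : Run (push k b) s 1 (Function.update s k (b :: s k))
  | seq {c d s t s' t' s''} : Run c s t s' → Run d s' t' s'' → Run (seq c d) s (t + t') s''
  | case_nil {k a b c s t s'} : s k = [] → Run a s t s' → Run (case k a b c) s (1 + t) s'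
  | case_false {k a b c s l t s'} : s k = false :: l → Run b (Function.update s k l) t s' →
      Run (case k a b c) s (1 + t) s'
  | case_true {k a b c s l t s'} : s k = true :: l → Run c (Function.update s k l) t s' →
      Run (case k a b c) s (1 + t) s'
  | loop_nil {k c d s} : s k = [] → Run (loop k c d) s 1 s
  | loop_false {k c d s l t s' t' s''} : s k = false :: l → Run c (Function.update s k l) t s' →
      Run (loop k c d) s' t' s'' → Run (loop k c d) s (1 + t + t') s''
  | loop_true {k c d s l t s' t' s''} : s k = true :: l → Run d (Function.update s k l) t s' →
      Run (loop k c d) s' t' s'' → Run (loop k c d) s (1 + t + t') s''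
  | while_nil {k c s} : s k = [] → Run (whileTrue k c) s 1 s
  | while_false {k c s l} : s k = false :: l → Run (whileTrue k c) s 1 (Function.update s k l)
  | while_true {k c s l t s' t' s''} : s k = true :: l → Run c (Function.update s k l) t s' →
      Run (whileTrue k c) s' t' s'' → Run (whileTrue k c) s (1 + t + t') s''

/-- The machine goes from one configuration to another one in exactly `t` steps. -/
def StepsTo {Λ : Type} (M : Λ → TM2.Stmt (fun _ : K => Bool) Λ (Option Bool)) (t : ℕ)
    (a b : TM2.Cfg (fun _ : K => Bool) Λ (Option Bool)) : Prop :=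
  (flip bind (TM2.step M))^[t] (some a) = some b

variable {Λ : Type} {M : Λ → TM2.Stmt (fun _ : K => Bool) Λ (Option Bool)}

theorem StepsTo.trans {t t' : ℕ} {a b c : TM2.Cfg (fun _ : K => Bool) Λ (Option Bool)}
    (h : StepsTo M t a b) (h' : StepsTo M t' b c) : StepsTo M (t + t') a c := by
  unfold StepsTo at *
  rw [add_comm, Function.iterate_add_apply, h, h']

theorem StepsTo.single {a b : TM2.Cfg (fun _ : K => Bool) Λ (Option Bool)}
    (h : TM2.step M a = some b) : StepsTo M 1 a b := h

theorem stepsTo_popGoto_nil {q x y z : Λ} {k : K} (hM : M q = popGoto k x y z)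
    {s : K → List Bool} (hs : s k = []) (v : Option Bool) :
    StepsTo M 1 ⟨some q, v, s⟩ ⟨some x, none, s⟩ := by
  refine .single ?_
  have : Function.update s k [] = s := by rw [← hs, Function.update_eq_self]
  simp [TM2.step, hM, popGoto, TM2.stepAux, hs, this]

theorem stepsTo_popGoto_false {q x y z : Λ} {k : K} (hM : M q = popGoto k x y z)
    {s : K → List Bool} {l : List Bool} (hs : s k = false :: l) (v : Option Bool) :
    StepsTo M 1 ⟨some q, v, s⟩ ⟨some y, some false, Function.update s k l⟩ := by
  refine .single ?_
  simp [TM2.step, hM, popGoto, TM2.stepAux, hs]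

theorem stepsTo_popGoto_true {q x y z : Λ} {k : K} (hM : M q = popGoto k x y z)
    {s : K → List Bool} {l : List Bool} (hs : s k = true :: l) (v : Option Bool) :
    StepsTo M 1 ⟨some q, v, s⟩ ⟨some z, some true, Function.update s k l⟩ := by
  refine .single ?_
  simp [TM2.step, hM, popGoto, TM2.stepAux, hs]

/-- The compiled program simulates the program step by step. -/
theorem Run.stepsTo {c : Cmd K} {s s' : K → List Bool} {t : ℕ} (h : Run c s t s')
    (e : Pos c → Λ) (ex : Λ) (hM : ∀ p, M (e p) = code c e ex p) (v : Option Bool) :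
    ∃ v', StepsTo M t ⟨some (e (entry c)), v, s⟩ ⟨some ex, v', s'⟩ := by
  induction h generalizing ex v with
  | skip s =>
    exact ⟨v, .single (by simp [TM2.step, hM, code, TM2.stepAux])⟩
  | push k b s =>
    exact ⟨v, .single (by simp [TM2.step, hM, code, TM2.stepAux])⟩
  | seq _ _ ih1 ih2 =>
    obtain ⟨v1, h1⟩ := ih1 _ _ (fun p => hM (.inl p)) v
    obtain ⟨v2, h2⟩ := ih2 _ _ (fun p => hM (.inr p)) v1
    exact ⟨v2, h1.trans h2⟩
  | case_nil hs _ ih =>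
    obtain ⟨v1, h1⟩ := ih _ _ (fun p => hM (.inr (.inl p))) none
    exact ⟨v1, (stepsTo_popGoto_nil (hM (.inl ())) hs v).trans h1⟩
  | case_false hs _ ih =>
    obtain ⟨v1, h1⟩ := ih _ _ (fun p => hM (.inr (.inr (.inl p)))) (some false)
    exact ⟨v1, (stepsTo_popGoto_false (hM (.inl ())) hs v).trans h1⟩
  | case_true hs _ ih =>
    obtain ⟨v1, h1⟩ := ih _ _ (fun p => hM (.inr (.inr (.inr p)))) (some true)
    exact ⟨v1, (stepsTo_popGoto_true (hM (.inl ())) hs v).trans h1⟩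
  | loop_nil hs => exact ⟨none, stepsTo_popGoto_nil (hM (.inl ())) hs v⟩
  | loop_false hs _ _ ih1 ih2 =>
    obtain ⟨v1, h1⟩ := ih1 _ _ (fun p => hM (.inr (.inl p))) (some false)
    obtain ⟨v2, h2⟩ := ih2 _ _ hM v1
    exact ⟨v2, ((stepsTo_popGoto_false (hM (.inl ())) hs v).trans h1).trans h2⟩
  | loop_true hs _ _ ih1 ih2 =>
    obtain ⟨v1, h1⟩ := ih1 _ _ (fun p => hM (.inr (.inr p))) (some true)
    obtain ⟨v2, h2⟩ := ih2 _ _ hM v1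
    exact ⟨v2, ((stepsTo_popGoto_true (hM (.inl ())) hs v).trans h1).trans h2⟩
  | while_nil hs => exact ⟨none, stepsTo_popGoto_nil (hM (.inl ())) hs v⟩
  | while_false hs => exact ⟨some false, stepsTo_popGoto_false (hM (.inl ())) hs v⟩
  | while_true hs _ _ ih1 ih2 =>
    obtain ⟨v1, h1⟩ := ih1 _ _ (fun p => hM (.inr p)) (some true)
    obtain ⟨v2, h2⟩ := ih2 _ _ hM v1
    exact ⟨v2, ((stepsTo_popGoto_true (hM (.inl ())) hs v).trans h1).trans h2⟩

/-- The compiled program as a Turing machine with input on the stack `k₀` and output on `k₁`. -/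
def toFinTM2 [Fintype K] (c : Cmd K) (k₀ k₁ : K) : FinTM2 where
  K := K
  k₀ := k₀
  k₁ := k₁
  Γ _ := Bool
  Λ := Option (Pos c)
  main := some (entry c)
  σ := Option Bool
  initialState := none
  m l := match l with
    -- A halting configuration must carry the initial internal state, so one last step resets it. It
    -- accounts for the `+ 1` in the time bound of `polyTime`.
    | none => .load (fun _ => none) .halt
    | some p => code c some none p

/-- `initList` and `haltList` put a word on a stack through a cast along `k = k₀`; since all stacks
hold bits, the cast is trivial. -/
theorem dite_mpr_eq_update {K : Type} [inst : DecidableEq K] {k₀ : K} (w : List Bool)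
    (hw : ∀ k, k = k₀ → List Bool = List Bool) :
    (fun k => @dite (List Bool) (k = k₀) (inst k k₀) (fun h => (hw k h).mpr w) fun _ => []) =
      Function.update (fun _ => []) k₀ w := by
  funext k
  by_cases hk : k = k₀
  · subst hk
    simp
  · simp [hk]

/-- A program that decides `f` within polynomial time gives a polynomial time machine. -/
theorem polyTime [Fintype K] {α : Type} (ea : α → List Bool) (f : α → Bool) (c : Cmd K) (k₀ k₁ : K)
    (p : Polynomial ℕ)
    (h : ∀ a, ∃ t ≤ p.eval (ea a).length, Run c (Function.update (fun _ => []) k₀ (ea a)) t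
      (Function.update (fun _ => []) k₁ [f a])) :
    Nonempty (TM2ComputableInPolyTime ea Computability.encodeBool f) := by
  refine ⟨⟨⟨c.toFinTM2 k₀ k₁, .refl Bool, .refl Bool⟩, p + 1, fun a => Classical.choice ?_⟩⟩
  choose t ht hrun using h
  refine ⟨⟨⟨t a + 1, ?_⟩, by simpa using ht a⟩⟩
  obtain ⟨v, hv⟩ := (hrun a).stepsTo (M := (c.toFinTM2 k₀ k₁).m) some none (fun _ => rfl) none
  have hfin : StepsTo (c.toFinTM2 k₀ k₁).m 1
      ⟨some none, v, Function.update (fun _ => []) k₁ [f a]⟩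
      ⟨none, none, Function.update (fun _ => []) k₁ [f a]⟩ := rfl
  have key := hv.trans hfin
  have hinit : initList (c.toFinTM2 k₀ k₁) (List.map (Equiv.refl Bool).invFun (ea a)) =
      ⟨some (some (entry c)), none, Function.update (fun _ => []) k₀ (ea a)⟩ := by
    unfold initList
    congr 1
    refine (dite_mpr_eq_update (k₀ := k₀) _ _).trans ?_
    exact congrArg _ (List.map_id _)
  have hhalt : haltList (c.toFinTM2 k₀ k₁)
      (List.map (Equiv.refl Bool).invFun (Computability.encodeBool (f a))) =
      ⟨none, none, Function.update (fun _ => []) k₁ [f a]⟩ := by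
    unfold haltList
    congr 1
    refine (dite_mpr_eq_update (k₀ := k₁) _ _).trans ?_
    exact congrArg _ (List.map_id _)
  rw [hinit, Option.map_some, hhalt]
  exact key

end Cmd

/-! ### Memory layout of the compiled programs. -/

/-- The stacks of the compiled programs: the number `n` of elements of the domain, four work
stacks, a stack of truth values, the value of each variable in unary, a loop counter for each
variable, and the arrays. -/
inductive Key (X M : Type) : Type
  | num | acc | aux | tmp | walk | out
  | var (x : X) | cnt (x : X) | mem (m : M)
  deriving DecidableEq, Fintype

namespace Cmd

section RunLe

variable {K : Type} [DecidableEq K]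

/-- From the stacks `s` the program `c` ends after at most `T` steps with the stacks `s'`. -/
def RunLe (c : Cmd K) (s : K → List Bool) (T : ℕ) (s' : K → List Bool) : Prop :=
  ∃ t ≤ T, Run c s t s'

theorem Run.le {c : Cmd K} {s s' : K → List Bool} {t T : ℕ} (h : Run c s t s') (ht : t ≤ T) :
    RunLe c s T s' := ⟨t, ht, h⟩

theorem RunLe.mono {c : Cmd K} {s s' : K → List Bool} {T T' : ℕ} (h : RunLe c s T s')
    (hT : T ≤ T') : RunLe c s T' s' := by
  obtain ⟨t, ht, h⟩ := h
  exact ⟨t, ht.trans hT, h⟩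

theorem RunLe.seq {c d : Cmd K} {s s' s'' : K → List Bool} {T T' : ℕ} (h : RunLe c s T s')
    (h' : RunLe d s' T' s'') : RunLe (.seq c d) s (T + T') s'' := by
  obtain ⟨t, ht, h⟩ := h
  obtain ⟨t', ht', h'⟩ := h'
  exact ⟨t + t', by omega, h.seq h'⟩

theorem RunLe.case_nil {k : K} {a b c : Cmd K} {s s' : K → List Bool} {T : ℕ} (hs : s k = [])
    (h : RunLe a s T s') : RunLe (.case k a b c) s (T + 1) s' := by
  obtain ⟨t, ht, h⟩ := h
  exact ⟨1 + t, by omega, .case_nil hs h⟩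

theorem RunLe.case_false {k : K} {a b c : Cmd K} {s s' : K → List Bool} {l : List Bool} {T : ℕ}
    (hs : s k = false :: l) (h : RunLe b (Function.update s k l) T s') :
    RunLe (.case k a b c) s (T + 1) s' := by
  obtain ⟨t, ht, h⟩ := h
  exact ⟨1 + t, by omega, .case_false hs h⟩

theorem RunLe.case_true {k : K} {a b c : Cmd K} {s s' : K → List Bool} {l : List Bool} {T : ℕ}
    (hs : s k = true :: l) (h : RunLe c (Function.update s k l) T s') :
    RunLe (.case k a b c) s (T + 1) s' := by
  obtain ⟨t, ht, h⟩ := h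
  exact ⟨1 + t, by omega, .case_true hs h⟩

/-- A loop over a stack that holds a unary number, which passes through the states
`F m, …, F 0`. -/
theorem runLe_loop_unary {k : K} {c d : Cmd K} (F : ℕ → K → List Bool) (m T : ℕ)
    (hF : ∀ i, F i k = List.replicate i true)
    (h : ∀ i < m, RunLe d (Function.update (F (i + 1)) k (List.replicate i true)) T (F i)) :
    RunLe (loop k c d) (F m) (m * (T + 1) + 1) (F 0) := by
  induction m with
  | zero => exact (Run.loop_nil (hF 0)).le (by omega)
  | succ m ih =>
    obtain ⟨t, ht, hr⟩ := h m (by omega)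
    obtain ⟨t', ht', hr'⟩ := ih fun i hi => h i (by omega)
    refine (Run.loop_true (hF (m + 1)) hr hr').le ?_
    rw [Nat.succ_mul]
    omega

/-- A loop over a stack, which passes through the states `F l` for the suffixes `l`. -/
theorem runLe_loop_list {k : K} {c d : Cmd K} (F : List Bool → K → List Bool) (T : ℕ)
    (hF : ∀ l, F l k = l)
    (h : ∀ b l, RunLe (if b then d else c) (Function.update (F (b :: l)) k l) T (F l))
    (l : List Bool) : RunLe (loop k c d) (F l) (l.length * (T + 1) + 1) (F []) := by
  induction l with
  | nil => exact (Run.loop_nil (hF [])).le (by omega)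
  | cons b l ih =>
    obtain ⟨t', ht', hr'⟩ := ih
    rw [List.length_cons, Nat.succ_mul]
    cases b
    · obtain ⟨t, ht, hr⟩ := h false l
      exact (Run.loop_false (hF _) hr hr').le (by omega)
    · obtain ⟨t, ht, hr⟩ := h true l
      exact (Run.loop_true (hF _) hr hr').le (by omega)

/-- Pop a stack until it is empty. -/
def clear (k : K) : Cmd K := loop k skip skip

theorem runLe_clear (k : K) (s : K → List Bool) :
    RunLe (clear k) s ((s k).length * 2 + 1) (Function.update s k []) := by
  have := runLe_loop_list (k := k) (c := skip) (d := skip) (fun l => Function.update s k l) 1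
    (by simp) (fun b l => by
      simp only [ite_self, Function.update_idem]
      exact (Run.skip _).le le_rfl) (s k)
  rwa [Function.update_eq_self] at this

end RunLe

end Cmd

open Cmd

variable {X M : Type} [DecidableEq X] [DecidableEq M]

/-- The contents of the stacks. -/
structure St (X M : Type) where
  n : ℕ
  acc : ℕ
  aux : ℕ
  tmp : ℕ
  walk : List Bool
  out : List Bool
  var : X → ℕ
  cnt : X → ℕ
  mem : M → List Bool

namespace St

/-- The stacks that are described by a state. -/
def bits (s : St X M) : Key X M → List Bool
  | .num => List.replicate s.n true
  | .acc => List.replicate s.acc true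
  | .aux => List.replicate s.aux true
  | .tmp => List.replicate s.tmp true
  | .walk => s.walk
  | .out => s.out
  | .var x => List.replicate (s.var x) true
  | .cnt x => List.replicate (s.cnt x) true
  | .mem m => s.mem m

variable {n a b t : ℕ} {w z : List Bool} {e γ : X → ℕ} {μ : M → List Bool}

/-- These update lemmas bring the stacks back to the form `bits` after every pop or push, so that
programs can be followed on states. -/
theorem update_num (i : ℕ) : Function.update (St.mk n a b t w z e γ μ).bits .num (List.replicate i true) =
    (St.mk i a b t w z e γ μ).bits := by
  funext k
  cases k <;> rfl

theorem update_acc (i : ℕ) : Function.update (St.mk n a b t w z e γ μ).bits .acc (List.replicate i true) =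
    (St.mk n i b t w z e γ μ).bits := by
  funext k
  cases k <;> rfl

theorem update_aux (i : ℕ) : Function.update (St.mk n a b t w z e γ μ).bits .aux (List.replicate i true) =
    (St.mk n a i t w z e γ μ).bits := by
  funext k
  cases k <;> rfl

theorem update_tmp (i : ℕ) : Function.update (St.mk n a b t w z e γ μ).bits .tmp (List.replicate i true) =
    (St.mk n a b i w z e γ μ).bits := by
  funext k
  cases k <;> rfl

theorem update_walk (l : List Bool) : Function.update (St.mk n a b t w z e γ μ).bits .walk l =
    (St.mk n a b t l z e γ μ).bits := by
  funext k
  cases k <;> rfl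

theorem update_out (l : List Bool) : Function.update (St.mk n a b t w z e γ μ).bits .out l =
    (St.mk n a b t w l e γ μ).bits := by
  funext k
  cases k <;> rfl

theorem update_var (x : X) (i : ℕ) : Function.update (St.mk n a b t w z e γ μ).bits (.var x) (List.replicate i true) =
    (St.mk n a b t w z (Function.update e x i) γ μ).bits := by
  funext k
  cases k with
  | var y =>
    by_cases hy : y = x
    · subst hy
      simp [bits]
    · simp [bits, hy]
  | _ => rfl

theorem update_cnt (x : X) (i : ℕ) : Function.update (St.mk n a b t w z e γ μ).bits (.cnt x) (List.replicate i true) =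
    (St.mk n a b t w z e (Function.update γ x i) μ).bits := by
  funext k
  cases k with
  | cnt y =>
    by_cases hy : y = x
    · subst hy
      simp [bits]
    · simp [bits, hy]
  | _ => rfl

theorem update_mem (x : M) (l : List Bool) : Function.update (St.mk n a b t w z e γ μ).bits (.mem x) l =
    (St.mk n a b t w z e γ (Function.update μ x l)).bits := by
  funext k
  cases k with
  | mem y =>
    by_cases hy : y = x
    · subst hy
      simp [bits]
    · simp [bits, hy]
  | _ => rfl

theorem push_num : RunLe (.push .num true) (St.mk n a b t w z e γ μ).bits 1
    (St.mk (n + 1) a b t w z e γ μ).bits := by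
  have := (Run.push .num true (St.mk n a b t w z e γ μ).bits).le le_rfl
  rwa [bits, ← List.replicate_succ, update_num] at this

theorem push_acc : RunLe (.push .acc true) (St.mk n a b t w z e γ μ).bits 1
    (St.mk n (a + 1) b t w z e γ μ).bits := by
  have := (Run.push .acc true (St.mk n a b t w z e γ μ).bits).le le_rfl
  rwa [bits, ← List.replicate_succ, update_acc] at this

theorem push_aux : RunLe (.push .aux true) (St.mk n a b t w z e γ μ).bits 1
    (St.mk n a (b + 1) t w z e γ μ).bits := by
  have := (Run.push .aux true (St.mk n a b t w z e γ μ).bits).le le_rfl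
  rwa [bits, ← List.replicate_succ, update_aux] at this

theorem push_tmp : RunLe (.push .tmp true) (St.mk n a b t w z e γ μ).bits 1
    (St.mk n a b (t + 1) w z e γ μ).bits := by
  have := (Run.push .tmp true (St.mk n a b t w z e γ μ).bits).le le_rfl
  rwa [bits, ← List.replicate_succ, update_tmp] at this

theorem push_walk (x : Bool) : RunLe (.push .walk x) (St.mk n a b t w z e γ μ).bits 1
    (St.mk n a b t (x :: w) z e γ μ).bits := by
  have := (Run.push .walk x (St.mk n a b t w z e γ μ).bits).le le_rfl
  rwa [update_walk] at this

theorem push_out (x : Bool) : RunLe (.push .out x) (St.mk n a b t w z e γ μ).bits 1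
    (St.mk n a b t w (x :: z) e γ μ).bits := by
  have := (Run.push .out x (St.mk n a b t w z e γ μ).bits).le le_rfl
  rwa [update_out] at this

theorem push_var (x : X) : RunLe (.push (.var x) true) (St.mk n a b t w z e γ μ).bits 1
    (St.mk n a b t w z (Function.update e x (e x + 1)) γ μ).bits := by
  have := (Run.push (.var x) true (St.mk n a b t w z e γ μ).bits).le le_rfl
  rwa [bits, ← List.replicate_succ, update_var] at this

theorem push_cnt (x : X) : RunLe (.push (.cnt x) true) (St.mk n a b t w z e γ μ).bits 1
    (St.mk n a b t w z e (Function.update γ x (γ x + 1)) μ).bits := by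
  have := (Run.push (.cnt x) true (St.mk n a b t w z e γ μ).bits).le le_rfl
  rwa [bits, ← List.replicate_succ, update_cnt] at this

theorem push_mem (m : M) (x : Bool) : RunLe (.push (.mem m) x) (St.mk n a b t w z e γ μ).bits 1
    (St.mk n a b t w z e γ (Function.update μ m (x :: μ m))).bits := by
  have := (Run.push (.mem m) x (St.mk n a b t w z e γ μ).bits).le le_rfl
  rwa [update_mem] at this

theorem _root_.StackProgram.Cmd.RunLe.to {c : Cmd (Key X M)} {s s' s'' : St X M} {T : ℕ}
    (h : RunLe c s.bits T s'.bits) (h' : s' = s'') : RunLe c s.bits T s''.bits := h' ▸ h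

end St

open St

variable {n a b t : ℕ} {w z : List Bool} {e γ : X → ℕ} {μ : M → List Bool}

/-! ### Unary arithmetic and addresses in base `n`. -/

section Arithmetic

variable (X M) in
/-- Add `n` to the auxiliary number. -/
def addNum : Cmd (Key X M) :=
  .seq (.loop .num .skip (.seq (.push .tmp true) (.push .aux true)))
    (.loop .tmp .skip (.push .num true))

/-- Reading a unary stack destroys it, so a copy is kept on `tmp` and poured back. The loop
invariants are indexed by the number of symbols left on the stack. The same scheme serves `addVar`,
`ltCmd` and `copyNum`. -/
theorem runLe_addNum : RunLe (addNum X M) (St.mk n a b 0 w z e γ μ).bits (n * 5 + 2)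
    (St.mk n a (b + n) 0 w z e γ μ).bits := by
  have h1 := runLe_loop_unary (k := .num) (c := .skip)
    (d := .seq (.push .tmp true) (.push .aux true))
    (fun i => (St.mk i a (b + (n - i)) (n - i) w z e γ μ).bits) n 2
    (fun i => rfl) (fun i hi => by
      rw [update_num]
      exact (push_tmp.seq push_aux).to (by congr 1 <;> omega))
  have h2 := runLe_loop_unary (k := .tmp) (c := .skip) (d := .push .num true)
    (fun i => (St.mk (n - i) a (b + n) i w z e γ μ).bits) n 1
    (fun i => rfl) (fun i hi => by
      rw [update_tmp]
      exact push_num.to (by congr 1; omega))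
  simp only [Nat.sub_self, Nat.sub_zero, Nat.add_zero] at h1 h2
  exact (h1.seq h2).mono (by omega)

variable (X M) in
/-- Multiply the address by `n`. -/
def mulNum : Cmd (Key X M) :=
  .seq (.loop .acc .skip (addNum X M)) (.loop .aux .skip (.push .acc true))

theorem runLe_mulNum : RunLe (mulNum X M) (St.mk n a 0 0 w z e γ μ).bits ((a + 1) * (n * 7 + 5))
    (St.mk n (a * n) 0 0 w z e γ μ).bits := by
  have h1 := runLe_loop_unary (k := .acc) (c := .skip) (d := addNum X M)
    (fun i => (St.mk n i ((a - i) * n) 0 w z e γ μ).bits) a (n * 5 + 2)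
    (fun i => rfl) (fun i hi => by
      rw [update_acc]
      refine runLe_addNum.to ?_
      rw [← Nat.succ_mul]
      congr 2
      omega)
  have h2 := runLe_loop_unary (k := .aux) (c := .skip) (d := .push .acc true)
    (fun i => (St.mk n (a * n - i) i 0 w z e γ μ).bits) (a * n) 1
    (fun i => rfl) (fun i hi => by
      rw [update_aux]
      exact push_acc.to (by congr 1; omega))
  simp only [Nat.sub_self, Nat.sub_zero, Nat.zero_mul] at h1 h2
  exact (h1.seq h2).mono (by ring_nf; omega)

variable (M) in
/-- Add the value of a variable to the address. -/
def addVar (x : X) : Cmd (Key X M) :=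
  .seq (.loop (.var x) .skip (.seq (.push .tmp true) (.push .acc true)))
    (.loop .tmp .skip (.push (.var x) true))

theorem update_succ_pred {e : X → ℕ} {x : X} {i : ℕ} (hi : i < e x) :
    Function.update (Function.update e x (e x - (i + 1))) x
      (Function.update e x (e x - (i + 1)) x + 1) = Function.update e x (e x - i) := by
  rw [Function.update_idem, Function.update_self]
  congr 1
  omega

theorem runLe_addVar (x : X) : RunLe (addVar M x) (St.mk n a b 0 w z e γ μ).bits (e x * 5 + 2)
    (St.mk n (a + e x) b 0 w z e γ μ).bits := by
  have h1 := runLe_loop_unary (k := .var x) (c := .skip)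
    (d := .seq (.push .tmp true) (.push .acc true))
    (fun i => (St.mk n (a + (e x - i)) b (e x - i) w z (Function.update e x i) γ μ).bits) (e x) 2
    (fun i => by simp [bits]) (fun i hi => by
      rw [update_var, Function.update_idem]
      exact (push_tmp.seq push_acc).to (by congr 1 <;> omega))
  have h2 := runLe_loop_unary (k := .tmp) (c := .skip) (d := .push (.var x) true)
    (fun i => (St.mk n (a + e x) b i w z (Function.update e x (e x - i)) γ μ).bits) (e x) 1
    (fun i => rfl) (fun i hi => by
      rw [update_tmp]
      exact (push_var x).to (by rw [update_succ_pred hi]))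
  simp only [Nat.sub_self, Nat.sub_zero, Nat.add_zero, Function.update_eq_self] at h1 h2
  exact (h1.seq h2).mono (by omega)

/-- The value in base `n` of a list of digits, with initial value `a`. -/
def address (n : ℕ) (e : X → ℕ) (a : ℕ) (ds : List X) : ℕ := ds.foldl (fun a x => a * n + e x) a

variable (M) in
/-- Compute an address. -/
def addrCmd : List X → Cmd (Key X M)
  | [] => .skip
  | x :: ds => .seq (.seq (mulNum X M) (addVar M x)) (addrCmd ds)

/-- The factor `a + 1` makes the bound inductive: one digit changes `a + 1` into at most `(a + 1) *
(n + 2)`. Values up to `n + 1` are allowed because a constant variable has the value `1` even if `n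
= 0`. -/
theorem runLe_addrCmd (ds : List X) : ∃ p : Polynomial ℕ, ∀ (n a : ℕ) (w z : List Bool)
    (e γ : X → ℕ) (μ : M → List Bool), (∀ x, e x ≤ n + 1) →
    RunLe (addrCmd M ds) (St.mk n a 0 0 w z e γ μ).bits ((a + 1) * p.eval n)
      (St.mk n (address n e a ds) 0 0 w z e γ μ).bits := by
  induction ds with
  | nil => exact ⟨1, fun n a w z e γ μ _ => (Run.skip _).le (by simp)⟩
  | cons x ds ih =>
    obtain ⟨p, hp⟩ := ih
    refine ⟨(Polynomial.X * 12 + 12) + (Polynomial.X + 2) * p, fun n a w z e γ μ he => ?_⟩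
    refine ((runLe_mulNum.seq (runLe_addVar x)).seq (hp n _ w z e γ μ he)).mono ?_
    have h1 := he x
    have h2 : (a * n + e x + 1) ≤ (a + 1) * (n + 2) := by nlinarith
    have h3 := Nat.mul_le_mul_right (p.eval n) h2
    simp only [Polynomial.eval_add, Polynomial.eval_mul, Polynomial.eval_X, Polynomial.eval_ofNat]
    nlinarith

omit [DecidableEq X] in
theorem address_le (ds : List X) : ∃ p : Polynomial ℕ, ∀ (n a : ℕ) (e : X → ℕ),
    (∀ x, e x ≤ n + 1) → address n e a ds + 1 ≤ (a + 1) * p.eval n := by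
  induction ds with
  | nil => exact ⟨1, fun n a e _ => by simp [address]⟩
  | cons x ds ih =>
    obtain ⟨p, hp⟩ := ih
    refine ⟨(Polynomial.X + 2) * p, fun n a e he => ?_⟩
    have h1 := he x
    have h2 : (a * n + e x + 1) ≤ (a + 1) * (n + 2) := by nlinarith
    have h3 := Nat.mul_le_mul_right (p.eval n) h2
    have h4 := hp n (a * n + e x) e he
    simp only [Polynomial.eval_add, Polynomial.eval_mul, Polynomial.eval_X, Polynomial.eval_ofNat]
    rw [← mul_assoc]
    exact h4.trans h3

end Arithmetic

/-! ### Reading and writing bits of arrays. -/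

section Arrays

variable (X) in
/-- Move as many bits of an array to the walking stack as the address says. -/
def forth (m : M) : Cmd (Key X M) :=
  .loop .acc .skip (.case (.mem m) .skip (.push .walk false) (.push .walk true))

theorem runLe_forth (m : M) : RunLe (forth X m) (St.mk n a b t [] z e γ μ).bits (a * 3 + 1)
    (St.mk n 0 b t ((μ m).take a).reverse z e γ (Function.update μ m ((μ m).drop a))).bits := by
  have h1 := runLe_loop_unary (k := .acc) (c := .skip)
    (d := .case (.mem m) .skip (.push .walk false) (.push .walk true))
    (fun i => (St.mk n i b t ((μ m).take (a - i)).reverse z e γ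
      (Function.update μ m ((μ m).drop (a - i)))).bits) a 2
    (fun i => rfl) (fun i hi => by
      rw [update_acc]
      obtain ⟨q, hq⟩ : ∃ q, q = a - (i + 1) := ⟨_, rfl⟩
      rw [← hq, show a - i = q + 1 by omega]
      by_cases hlt : q < (μ m).length
      · have hd : (μ m).drop q = (μ m)[q] :: (μ m).drop (q + 1) := List.drop_eq_getElem_cons hlt
        have ht : ((μ m).take (q + 1)).reverse = (μ m)[q] :: ((μ m).take q).reverse := by
          rw [← List.take_concat_get' _ _ hlt]
          simp
        rw [ht]
        cases hb : (μ m)[q] with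
        | false =>
          refine .case_false (l := (μ m).drop (q + 1)) (by simp [bits, hd, hb]) ?_
          rw [update_mem, Function.update_idem]
          exact push_walk _
        | true =>
          refine .case_true (l := (μ m).drop (q + 1)) (by simp [bits, hd, hb]) ?_
          rw [update_mem, Function.update_idem]
          exact push_walk _
      -- The address exceeds the array: further steps move nothing. Thus reading there gives the
      -- default `false` and writing there has no effect, as with `getD` and `List.set`.
      · have h1 : (μ m).drop q = [] := List.drop_eq_nil_of_le (by omega)
        have h2 : (μ m).drop (q + 1) = [] := List.drop_eq_nil_of_le (by omega)
        have h3 : (μ m).take q = μ m := List.take_of_length_le (by omega)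
        have h4 : (μ m).take (q + 1) = μ m := List.take_of_length_le (by omega)
        rw [h1, h2, h3, h4]
        exact .case_nil (by simp [bits]) ((Run.skip _).le le_rfl))
  simpa [forth] using h1

variable (X) in
/-- Move the bits on the walking stack back to an array. -/
def back (m : M) : Cmd (Key X M) :=
  .loop .walk (.push (.mem m) false) (.push (.mem m) true)

theorem runLe_back (m : M) (l r : List Bool) :
    RunLe (back X m) (St.mk n a b t l z e γ (Function.update μ m r)).bits (l.length * 2 + 1)
      (St.mk n a b t [] z e γ (Function.update μ m (l.reverse ++ r))).bits := by
  induction l generalizing r with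
  | nil => exact (Run.loop_nil (by rfl)).le (by omega)
  | cons x l ih =>
    obtain ⟨t₁, ht₁, h₁⟩ := ih (x :: r)
    have h := push_mem (n := n) (a := a) (b := b) (t := t) (w := l) (z := z) (e := e) (γ := γ)
      (μ := Function.update μ m r) m x
    rw [Function.update_idem, Function.update_self] at h
    obtain ⟨t₂, ht₂, h₂⟩ := h
    rw [List.reverse_cons, List.append_assoc, List.singleton_append]
    cases x
    · refine (Run.loop_false (l := l) (by rfl) ?_ h₁).le (t := 1 + t₂ + t₁)
        (by simp only [List.length_cons]; omega)
      rwa [update_walk]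
    · refine (Run.loop_true (l := l) (by rfl) ?_ h₁).le (t := 1 + t₂ + t₁)
        (by simp only [List.length_cons]; omega)
      rwa [update_walk]

variable (X) in
/-- Read the bit of an array at the address. -/
def read (m : M) : Cmd (Key X M) :=
  .seq (forth X m) (.seq (.case (.mem m) (.push .out false)
    (.seq (.push (.mem m) false) (.push .out false))
    (.seq (.push (.mem m) true) (.push .out true))) (back X m))

theorem runLe_read (m : M) : RunLe (read X m) (St.mk n a b t [] z e γ μ).bits ((a + 1) * 5)
    (St.mk n 0 b t [] ((μ m).getD a false :: z) e γ μ).bits := by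
  have h3 := runLe_back (n := n) (a := 0) (b := b) (t := t) (z := (μ m).getD a false :: z) (e := e)
    (γ := γ) (μ := μ) m ((μ m).take a).reverse ((μ m).drop a)
  rw [List.reverse_reverse, List.take_append_drop, Function.update_eq_self] at h3
  have hlen : ((μ m).take a).reverse.length ≤ a := by simp
  refine ((runLe_forth m).seq (RunLe.seq (T := 3) ?_ h3)).mono (by omega)
  cases hd : (μ m).drop a with
  | nil =>
    have : (μ m).getD a false = false := by
      rw [List.getD_eq_getElem?_getD, List.getElem?_eq_none (List.drop_eq_nil_iff.1 hd)]
      rfl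
    rw [this]
    exact (RunLe.case_nil (by simp [bits]) (push_out _)).mono (by omega)
  | cons x l =>
    have : (μ m).getD a false = x := by
      have h := congrArg (fun l => l[0]?) hd
      simp only [List.getElem?_drop, Nat.add_zero] at h
      rw [List.getD_eq_getElem?_getD, h]
      rfl
    rw [this]
    cases x
    · refine .case_false (l := l) (by simp [bits]) ?_
      rw [update_mem]
      exact ((push_mem m _).seq (push_out _)).to (by simp)
    · refine .case_true (l := l) (by simp [bits]) ?_
      rw [update_mem]
      exact ((push_mem m _).seq (push_out _)).to (by simp)

variable (X) in
/-- Set the bit of an array at the address. -/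
def write (m : M) : Cmd (Key X M) :=
  .seq (forth X m) (.seq (.case (.mem m) .skip (.push (.mem m) true) (.push (.mem m) true))
    (back X m))

theorem runLe_write (m : M) : RunLe (write X m) (St.mk n a b t [] z e γ μ).bits ((a + 1) * 5)
    (St.mk n 0 b t [] z e γ (Function.update μ m ((μ m).set a true))).bits := by
  have h3 := runLe_back (n := n) (a := 0) (b := b) (t := t) (z := z) (e := e)
    (γ := γ) (μ := μ) m ((μ m).take a).reverse (((μ m).set a true).drop a)
  have ht : (μ m).take a = ((μ m).set a true).take a := by
    rw [List.take_set_of_le le_rfl]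
  rw [List.reverse_reverse, ht, List.take_append_drop, ← ht] at h3
  have hlen : ((μ m).take a).reverse.length ≤ a := by simp
  refine ((runLe_forth m).seq (RunLe.seq (T := 2) ?_ h3)).mono (by omega)
  rw [List.drop_set]
  simp only [lt_irrefl, if_false, Nat.sub_self]
  cases hd : (μ m).drop a with
  | nil => exact RunLe.case_nil (by simp [bits]) ((Run.skip _).le le_rfl)
  | cons x l =>
    cases x
    · refine .case_false (l := l) (by simp [bits]) ?_
      rw [update_mem]
      exact (push_mem m _).to (by simp)
    · refine .case_true (l := l) (by simp [bits]) ?_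
      rw [update_mem]
      exact (push_mem m _).to (by simp)

end Arrays

/-! ### Comparison of variables and bounded loops. -/

section Variables

variable (M) in
/-- Compare two variables. -/
def ltCmd (x y : X) : Cmd (Key X M) :=
  .seq (addVar M y) (.seq (.loop (.var x) .skip (.seq (.push .tmp true) (.case .acc .skip .skip .skip)))
    (.seq (.loop .tmp .skip (.push (.var x) true))
      (.case .acc (.push .out false) .skip (.seq (.push .out true) (clear .acc)))))

/-- Truncated subtraction: `acc` receives `e y` and is popped `e x` times, so it is nonempty at the
end exactly when `e x < e y`. -/
theorem runLe_ltCmd (x y : X) (hx : e x ≤ n + 1) (hy : e y ≤ n + 1) :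
    RunLe (ltCmd M x y) (St.mk n 0 b 0 w z e γ μ).bits (n * 16 + 26)
      (St.mk n 0 b 0 w (decide (e x < e y) :: z) e γ μ).bits := by
  have h1 := runLe_addVar (n := n) (a := 0) (b := b) (w := w) (z := z) (e := e) (γ := γ) (μ := μ) y
  have h2 := runLe_loop_unary (k := .var x) (c := .skip)
    (d := .seq (.push .tmp true) (.case .acc .skip .skip .skip))
    (fun i => (St.mk n (e y - (e x - i)) b (e x - i) w z (Function.update e x i) γ μ).bits) (e x) 3
    (fun i => by simp [bits]) (fun i hi => by
      rw [update_var, Function.update_idem]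
      refine RunLe.seq (T := 1) (T' := 2) push_tmp ?_
      rw [show e x - (i + 1) + 1 = e x - i by omega]
      by_cases h0 : e y ≤ e x - (i + 1)
      · rw [show e y - (e x - (i + 1)) = 0 by omega, show e y - (e x - i) = 0 by omega]
        exact .case_nil (by rfl) ((Run.skip _).le le_rfl)
      · rw [show e y - (e x - (i + 1)) = e y - (e x - i) + 1 by omega]
        refine .case_true (l := List.replicate (e y - (e x - i)) true) (by rfl) ?_
        rw [update_acc]
        exact (Run.skip _).le le_rfl)
  have h3 := runLe_loop_unary (k := .tmp) (c := .skip) (d := .push (.var x) true)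
    (fun i => (St.mk n (e y - e x) b i w z (Function.update e x (e x - i)) γ μ).bits) (e x) 1
    (fun i => rfl) (fun i hi => by
      rw [update_tmp]
      exact (push_var x).to (by rw [update_succ_pred hi]))
  simp only [Nat.sub_self, Nat.sub_zero, Nat.zero_add, Function.update_eq_self] at h1 h2 h3
  have h4 : RunLe (.case .acc (.push .out false) .skip (.seq (.push .out true) (clear .acc)))
      (St.mk n (e y - e x) b 0 w z e γ μ).bits (e y * 2 + 3)
      (St.mk n 0 b 0 w (decide (e x < e y) :: z) e γ μ).bits := by
    by_cases hlt : e x < e y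
    · obtain ⟨q, hq⟩ : ∃ q, e y - e x = q + 1 := ⟨e y - e x - 1, by omega⟩
      rw [hq]
      refine (RunLe.case_true (l := List.replicate q true) (by rfl) ?_ (T := 1 + (q * 2 + 1))).mono
        (by omega)
      rw [update_acc]
      refine (push_out true).seq ?_
      have := runLe_clear (.acc : Key X M) (St.mk n q b 0 w (true :: z) e γ μ).bits
      rw [← List.replicate_zero (a := true), update_acc] at this
      simpa [bits, hlt] using this
    · rw [show e y - e x = 0 by omega]
      refine (RunLe.case_nil (by rfl) ((push_out false).to ?_)).mono (by omega)
      simp [hlt]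
  exact (h1.seq (h2.seq (h3.seq h4))).mono (by omega)

variable (M) in
/-- Set up a loop counter. -/
def copyNum (x : X) : Cmd (Key X M) :=
  .seq (.loop .num .skip (.seq (.push .tmp true) (.push (.cnt x) true)))
    (.loop .tmp .skip (.push .num true))

theorem runLe_copyNum (x : X) (hx : γ x = 0) :
    RunLe (copyNum M x) (St.mk n a b 0 w z e γ μ).bits (n * 5 + 2)
      (St.mk n a b 0 w z e (Function.update γ x n) μ).bits := by
  have h1 := runLe_loop_unary (k := .num) (c := .skip)
    (d := .seq (.push .tmp true) (.push (.cnt x) true))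
    (fun i => (St.mk i a b (n - i) w z e (Function.update γ x (n - i)) μ).bits) n 2
    (fun i => rfl) (fun i hi => by
      rw [update_num]
      refine (push_tmp.seq (push_cnt x)).to ?_
      rw [Function.update_idem, Function.update_self, show n - (i + 1) + 1 = n - i by omega])
  have h2 := runLe_loop_unary (k := .tmp) (c := .skip) (d := .push .num true)
    (fun i => (St.mk (n - i) a b i w z e (Function.update γ x n) μ).bits) n 1
    (fun i => rfl) (fun i hi => by
      rw [update_tmp]
      exact push_num.to (by congr 1; omega))
  simp only [Nat.sub_self, Nat.sub_zero] at h1 h2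
  rw [← hx, Function.update_eq_self] at h1
  rw [hx] at h1
  exact (h1.seq h2).mono (by omega)

/-- Run a program for all values less than `n` of a variable. -/
def forCmd (x : X) (c : Cmd (Key X M)) : Cmd (Key X M) :=
  .seq (copyNum M x) (.seq (.loop (.cnt x) .skip (.seq c (.push (.var x) true))) (clear (.var x)))

/-- The variable counts up while its counter counts down, whence `i + j + 1 = n` inside the body.
Both are `0` before and after, so the loop can itself be the body of a loop over another variable.
-/
theorem runLe_forCmd {x : X} {c : Cmd (Key X M)} {T : ℕ} (Z : ℕ → List Bool)
    (U : ℕ → M → List Bool) (he : e x = 0) (hγ : γ x = 0)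
    (h : ∀ i j, i + j + 1 = n →
      RunLe c (St.mk n 0 0 0 [] (Z i) (Function.update e x i) (Function.update γ x j) (U i)).bits T
      (St.mk n 0 0 0 [] (Z (i + 1)) (Function.update e x i) (Function.update γ x j)
        (U (i + 1))).bits) :
    RunLe (forCmd x c) (St.mk n 0 0 0 [] (Z 0) e γ (U 0)).bits (n * (T + 9) + 4)
      (St.mk n 0 0 0 [] (Z n) e γ (U n)).bits := by
  have h2 := runLe_loop_unary (k := .cnt x) (c := .skip)
    (d := .seq c (.push (.var x) true))
    (fun i => (St.mk n 0 0 0 [] (Z (n - i)) (Function.update e x (n - i)) (Function.update γ x i)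
      (U (n - i))).bits) n (T + 1)
    (fun i => by simp [bits]) (fun i hi => by
      rw [update_cnt, Function.update_idem]
      have h' := h (n - (i + 1)) i (by omega)
      rw [show n - (i + 1) + 1 = n - i by omega] at h'
      refine h'.seq ((push_var x).to ?_)
      rw [Function.update_idem, Function.update_self, show n - (i + 1) + 1 = n - i by omega])
  have h3 := runLe_clear (.var x : Key X M)
    (St.mk n 0 0 0 [] (Z n) (Function.update e x n) γ (U n)).bits
  have hu : Function.update (Function.update e x n) x 0 = e := by
    rw [Function.update_idem, ← he, Function.update_eq_self]
  rw [← List.replicate_zero (a := true), update_var, hu] at h3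
  simp only [Nat.sub_self, Nat.sub_zero] at h2
  have h0 : Function.update e x 0 = e := by rw [← he, Function.update_eq_self]
  have h0' : Function.update γ x 0 = γ := by rw [← hγ, Function.update_eq_self]
  rw [h0, h0'] at h2
  refine ((runLe_copyNum x hγ).seq (h2.seq h3)).mono ?_
  simp only [bits, Function.update_self, List.length_replicate]
  ring_nf
  omega

end Variables

/-! ### First order formulas and their evaluation in polynomial time. -/

/-- First order formulas whose atoms compare variables and look up bits of arrays. -/
inductive Fm (X M : Type) : Type
  | bit (m : M) (ds : List X)
  | lt (x y : X)
  | not (φ : Fm X M)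
  | and (φ ψ : Fm X M)
  | ex (x : X) (φ : Fm X M)

namespace Fm

/-- The truth value of a formula in the domain `{0, …, n - 1}`. -/
def eval (n : ℕ) (μ : M → List Bool) : Fm X M → (X → ℕ) → Bool
  | bit m ds, e => (μ m).getD (address n e 0 ds) false
  | lt x y, e => decide (e x < e y)
  | not φ, e => !(eval n μ φ e)
  | and φ ψ, e => eval n μ φ e && eval n μ ψ e
  | ex x φ, e => (List.range n).any fun i => eval n μ φ (Function.update e x i)

/-- The bound variables of a formula. -/
def bv : Fm X M → List X
  | bit _ _ => []
  | lt _ _ => []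
  | not φ => bv φ
  | and φ ψ => bv φ ++ bv ψ
  | ex x φ => x :: bv φ

/-- No variable is bound twice on a branch of the formula. -/
def WF : Fm X M → Prop
  | bit _ _ => True
  | lt _ _ => True
  | not φ => WF φ
  | and φ ψ => WF φ ∧ WF ψ
  | ex x φ => x ∉ bv φ ∧ WF φ

/-- A program that pushes the truth value of a formula. -/
def cmd : Fm X M → Cmd (Key X M)
  | bit m ds => .seq (addrCmd M ds) (read X m)
  | lt x y => ltCmd M x y
  | not φ => .seq (cmd φ) (.case .out .skip (.push .out true) (.push .out false))
  | and φ ψ => .seq (cmd φ) (.seq (cmd ψ)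
      (.case .out .skip (.seq (.case .out .skip .skip .skip) (.push .out false)) .skip))
  | ex x φ => .seq (.push .out false) (forCmd x (.seq (cmd φ)
      (.case .out .skip .skip (.seq (.case .out .skip .skip .skip) (.push .out true)))))

theorem runLe_pop_out (x : Bool) :
    RunLe (.case .out .skip .skip .skip) (St.mk n a b t w (x :: z) e γ μ).bits 2
      (St.mk n a b t w z e γ μ).bits := by
  cases x
  · refine .case_false (l := z) (by rfl) ?_
    rw [update_out]
    exact (Run.skip _).le le_rfl
  · refine .case_true (l := z) (by rfl) ?_
    rw [update_out]
    exact (Run.skip _).le le_rfl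

theorem update_le {x : X} {i : ℕ} (he : ∀ x, e x ≤ n + 1) (hi : i < n) (y : X) :
    Function.update e x i y ≤ n + 1 := by
  by_cases hy : y = x
  · subst hy
    rw [Function.update_self]
    omega
  · rw [Function.update_of_ne hy]
    exact he y

/-- Formulas are evaluated in polynomial time. -/
theorem runLe_cmd (φ : Fm X M) (hφ : φ.WF) : ∃ p : Polynomial ℕ, ∀ (n : ℕ) (e γ : X → ℕ)
    (μ : M → List Bool) (z : List Bool), (∀ x, e x ≤ n + 1) →
    (∀ x ∈ φ.bv, e x = 0 ∧ γ x = 0) →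
    RunLe φ.cmd (St.mk n 0 0 0 [] z e γ μ).bits (p.eval n)
      (St.mk n 0 0 0 [] (φ.eval n μ e :: z) e γ μ).bits := by
  induction φ with
  | bit m ds =>
    obtain ⟨p, hp⟩ := runLe_addrCmd (M := M) ds
    obtain ⟨q, hq⟩ := address_le ds
    refine ⟨p + q * 5, fun n e γ μ z he _ => ((hp n 0 [] z e γ μ he).seq (runLe_read m)).mono ?_⟩
    have := hq n 0 e he
    simp only [Polynomial.eval_add, Polynomial.eval_mul, Polynomial.eval_ofNat]
    omega
  | lt x y =>
    exact ⟨Polynomial.X * 16 + 26, fun n e γ μ z he _ =>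
      (runLe_ltCmd x y (he x) (he y)).mono (by simp)⟩
  | not φ ih =>
    obtain ⟨p, hp⟩ := ih hφ
    refine ⟨p + 2, fun n e γ μ z he hb => ((hp n e γ μ z he hb).seq
      (RunLe.mono (T := 2) ?_ le_rfl)).mono (by simp)⟩
    simp only [eval]
    cases eval n μ φ e
    · refine .case_false (l := z) (by rfl) ?_
      rw [update_out]
      exact push_out _
    · refine .case_true (l := z) (by rfl) ?_
      rw [update_out]
      exact push_out _
  | and φ ψ ih₁ ih₂ =>
    obtain ⟨p, hp⟩ := ih₁ hφ.1
    obtain ⟨q, hq⟩ := ih₂ hφ.2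
    refine ⟨p + q + 4, fun n e γ μ z he hb => ((hp n e γ μ z he fun x hx => hb x (by simp [bv, hx])).seq
      ((hq n e γ μ _ he fun x hx => hb x (by simp [bv, hx])).seq (RunLe.mono (T := 4) ?_ le_rfl))).mono
      (by simp; omega)⟩
    simp only [eval]
    cases eval n μ ψ e
    · refine .case_false (T := 3) (l := eval n μ φ e :: z) (by rfl) ?_
      rw [update_out, Bool.and_false]
      exact (runLe_pop_out _).seq (push_out _)
    · refine (RunLe.case_true (T := 1) (l := eval n μ φ e :: z) (by rfl) ?_).mono (by omega)
      rw [update_out, Bool.and_true]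
      exact (Run.skip _).le le_rfl
  | ex x φ ih =>
    obtain ⟨p, hp⟩ := ih hφ.2
    refine ⟨1 + (Polynomial.X * (p + 4 + 9) + 4), fun n e γ μ z he hb => ?_⟩
    have key := runLe_forCmd (n := n) (e := e) (γ := γ) (x := x) (T := p.eval n + 4)
      (c := .seq (cmd φ)
        (.case .out .skip .skip (.seq (.case .out .skip .skip .skip) (.push .out true))))
      -- The top of `out` accumulates the disjunction over the values already tried.
      (fun i => ((List.range i).any fun i => eval n μ φ (Function.update e x i)) :: z)
      (fun _ => μ) (hb x (by simp [bv])).1 (hb x (by simp [bv])).2 (fun i j hij => by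
        refine (hp n _ _ μ _ (update_le he (by omega)) ?_).seq ?_
        · intro y hy
          have : y ≠ x := fun h => hφ.1 (h ▸ hy)
          simpa [this] using hb y (by simp [bv, hy])
        · simp only [List.range_succ, List.any_append, List.any_cons, List.any_nil, Bool.or_false]
          cases eval n μ φ (Function.update e x i)
          · refine (RunLe.case_false (T := 1) (l := _ :: z) (by rfl) ?_).mono (by omega)
            rw [update_out, Bool.or_false]
            exact (Run.skip _).le le_rfl
          · refine .case_true (T := 3) (l := _ :: z) (by rfl) ?_
            rw [update_out, Bool.or_true]
            exact (runLe_pop_out _).seq (push_out _))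
    refine ((push_out false).seq key).mono ?_
    simp

end Fm

/-! ### Array programs with bounded loops. -/

/-- Programs that work with arrays. -/
inductive Prog (X M : Type) : Type
  /-- sequential composition -/
  | seq (c d : Prog X M)
  /-- run a program for all values of a variable -/
  | all (x : X) (c : Prog X M)
  /-- set a bit of an array if a formula holds -/
  | setIf (φ : Fm X M) (m : M) (ds : List X)
  /-- extend an array by `false` -/
  | grow (m : M)

namespace Prog

/-- The effect of a program on the arrays. -/
def run (n : ℕ) : Prog X M → (X → ℕ) → (M → List Bool) → M → List Bool
  | seq c d, e, μ => run n d e (run n c e μ)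
  | all x c, e, μ => (List.range n).foldl (fun μ i => run n c (Function.update e x i) μ) μ
  | setIf φ m ds, e, μ => if φ.eval n μ e then
      Function.update μ m ((μ m).set (address n e 0 ds) true) else μ
  | grow m, _, μ => Function.update μ m (false :: μ m)

/-- The bound variables of a program. -/
def bv : Prog X M → List X
  | seq c d => bv c ++ bv d
  | all x c => x :: bv c
  | setIf φ _ _ => φ.bv
  | grow _ => []

/-- No variable is bound twice on a branch of the program. -/
def WF : Prog X M → Prop
  | seq c d => WF c ∧ WF d
  | all x c => x ∉ bv c ∧ WF c
  | setIf φ _ _ => φ.WF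
  | grow _ => True

/-- The compiled program. -/
def cmd : Prog X M → Cmd (Key X M)
  | seq c d => .seq (cmd c) (cmd d)
  | all x c => forCmd x (cmd c)
  | setIf φ m ds => .seq φ.cmd (.case .out .skip .skip (.seq (addrCmd M ds) (write X m)))
  | grow m => .push (.mem m) false

/-- Programs run in polynomial time. -/
theorem runLe_cmd (c : Prog X M) (hc : c.WF) : ∃ p : Polynomial ℕ, ∀ (n : ℕ) (e γ : X → ℕ)
    (μ : M → List Bool) (z : List Bool), (∀ x, e x ≤ n + 1) →
    (∀ x ∈ c.bv, e x = 0 ∧ γ x = 0) →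
    RunLe c.cmd (St.mk n 0 0 0 [] z e γ μ).bits (p.eval n)
      (St.mk n 0 0 0 [] z e γ (c.run n e μ)).bits := by
  induction c with
  | seq c d ih₁ ih₂ =>
    obtain ⟨p, hp⟩ := ih₁ hc.1
    obtain ⟨q, hq⟩ := ih₂ hc.2
    exact ⟨p + q, fun n e γ μ z he hb =>
      ((hp n e γ μ z he fun x hx => hb x (by simp [bv, hx])).seq
      (hq n e γ _ z he fun x hx => hb x (by simp [bv, hx]))).mono (by simp)⟩
  | all x c ih =>
    obtain ⟨p, hp⟩ := ih hc.2
    refine ⟨Polynomial.X * (p + 9) + 4, fun n e γ μ z he hb => ?_⟩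
    have key := runLe_forCmd (n := n) (e := e) (γ := γ) (x := x) (T := p.eval n)
      (c := cmd c) (fun _ => z)
      (fun i => (List.range i).foldl (fun μ i => run n c (Function.update e x i) μ) μ)
      (hb x (by simp [bv])).1 (hb x (by simp [bv])).2 (fun i j hij => by
        rw [List.range_succ, List.foldl_append]
        refine hp n _ _ _ _ (Fm.update_le he (by omega)) ?_
        intro y hy
        have : y ≠ x := fun h => hc.1 (h ▸ hy)
        simpa [this] using hb y (by simp [bv, hy]))
    exact key.mono (by simp)
  | setIf φ m ds =>
    obtain ⟨p₀, hp₀⟩ := φ.runLe_cmd hc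
    obtain ⟨p, hp⟩ := runLe_addrCmd (M := M) ds
    obtain ⟨q, hq⟩ := address_le ds
    refine ⟨p₀ + 2 + (p + q * 5), fun n e γ μ z he hb =>
      ((hp₀ n e γ μ z he hb).seq (T' := (p + q * 5).eval n + 2) ?_).mono (by simp [add_assoc, add_comm])⟩
    have := hq n 0 e he
    simp only [run]
    cases φ.eval n μ e
    · refine (RunLe.case_false (T := 1) (l := z) (by rfl) ?_).mono (by omega)
      rw [update_out]
      exact (Run.skip _).le le_rfl
    · refine (RunLe.case_true (l := z) (by rfl) ?_).mono (T := p.eval n + q.eval n * 5 + 1)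
        (by simp)
      rw [update_out]
      refine ((hp n 0 [] z e γ μ he).seq (runLe_write m)).mono (by omega)
  | grow m => exact ⟨1, fun n e γ μ z he hb => (push_mem m false).mono (by simp)⟩

end Prog

end StackProgram

/-! ### The concrete program that decides the problem. -/

namespace TokenSliding

open StackProgram TSInstance

/-- The variables of the program. -/
inductive Var : Type
  | a | v | b | x | u | c | y | t₁ | t₂ | t₃ | t₄ | one | zero
  deriving DecidableEq

set_option linter.constructorNameAsVariable false

instance : Fintype Var where
  elems := {.a, .v, .b, .x, .u, .c, .y, .t₁, .t₂, .t₃, .t₄, .one, .zero}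
  complete p := by cases p <;> simp

/-- The arrays of the program: the input without the number of vertices, and the relations that
are computed from the two independent sets. -/
inductive Arr : Type
  | inp | rel (s : Bool)
  deriving DecidableEq, Fintype

namespace Formula

open Fm

variable {X M : Type}

/-- Disjunction. -/
def or (φ ψ : Fm X M) : Fm X M := not (and (not φ) (not ψ))

/-- Universal quantification. -/
def all (x : X) (φ : Fm X M) : Fm X M := not (ex x (not φ))

/-- Equality of variables. -/
def eq (x y : X) : Fm X M := and (not (lt x y)) (not (lt y x))

section

variable [DecidableEq X] {n : ℕ} {μ : M → List Bool} {e : X → ℕ}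

theorem eval_not {φ : Fm X M} : (not φ).eval n μ e = true ↔ ¬ φ.eval n μ e = true := by
  simp [eval]

theorem eval_and {φ ψ : Fm X M} :
    (and φ ψ).eval n μ e = true ↔ φ.eval n μ e = true ∧ ψ.eval n μ e = true := by
  simp [eval]

theorem eval_or {φ ψ : Fm X M} :
    (or φ ψ).eval n μ e = true ↔ φ.eval n μ e = true ∨ ψ.eval n μ e = true := by
  simp only [or, eval_not, eval_and]
  tauto

theorem eval_ex {x : X} {φ : Fm X M} : (ex x φ).eval n μ e = true ↔
    ∃ i : Fin n, φ.eval n μ (Function.update e x i) = true := by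
  simp only [eval, List.any_eq_true, List.mem_range]
  exact ⟨fun ⟨i, hi, h⟩ => ⟨⟨i, hi⟩, h⟩, fun ⟨i, h⟩ => ⟨i, i.2, h⟩⟩

theorem eval_all {x : X} {φ : Fm X M} : (all x φ).eval n μ e = true ↔
    ∀ i : Fin n, φ.eval n μ (Function.update e x i) = true := by
  simp only [all, eval_not, eval_ex]
  push Not
  rfl

theorem eval_eq {x y : X} : (eq x y : Fm X M).eval n μ e = true ↔ e x = e y := by
  rw [eq, eval_and, eval_not, eval_not]
  simp only [eval, decide_eq_true_eq]
  omega

theorem eval_bit {m : M} {ds : List X} : (bit m ds).eval n μ e = true ↔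
    (μ m).getD (address n e 0 ds) false = true := Iff.rfl

end

/-- Adjacency. -/
def adj (u v : Var) : Fm Var Arr := bit .inp [u, v]

/-- Membership in one of the two independent sets. -/
def mem (s : Bool) (v : Var) : Fm Var Arr := bit .inp [.one, if s then .one else .zero, v]

/-- The relation that is computed. -/
def rel (s : Bool) (a v b x : Var) : Fm Var Arr := bit (.rel s) [a, v, b, x]

/-- Distinct nonadjacent vertices. -/
def free (x y : Var) : Fm Var Arr := and (not (eq x y)) (not (adj x y))

/-- One derivation step. -/
def step (s : Bool) : Fm Var Arr :=
  or (and (mem s .a) (and (mem s .b) (and (eq .v .a) (eq .x .b))))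
    (or (rel s .b .x .a .v)
      (ex .u (and (adj .u .v) (and
        (all .c (or (not (mem s .c)) (or (eq .c .a) (ex .y (and (rel s .a .u .c .y) (free .y .v))))))
        (or (and (eq .a .b) (and (eq .x .v) (rel s .a .u .a .u)))
          (and (not (eq .a .b)) (and (rel s .a .u .b .x) (free .x .v))))))))

/-- The tokens of the two independent sets have the same sets of possible positions. -/
def same : Fm Var Arr :=
  all .a (or (not (mem false .a)) (ex .b (and (mem true .b)
    (all .u (or (and (rel false .a .u .a .u) (rel true .b .u .b .u))
      (and (not (rel false .a .u .a .u)) (not (rel true .b .u .b .u))))))))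

end Formula

/-- Nested loops. -/
def alls {X M : Type} (xs : List X) (c : Prog X M) : Prog X M := xs.foldr Prog.all c

/-- Initialize a relation. -/
def fill (s : Bool) : Prog Var Arr := alls [.a, .v, .b, .x] (.grow (.rel s))

/-- Apply the derivation step to all tuples. -/
def round (s : Bool) : Prog Var Arr :=
  alls [.a, .v, .b, .x] (.setIf (Formula.step s) (.rel s) [.a, .v, .b, .x])

/-- Compute a relation. -/
def closure (s : Bool) : Prog Var Arr :=
  .seq (fill s) (alls [.t₁, .t₂, .t₃, .t₄] (round s))

/-- Compute both relations. -/
def closures : Prog Var Arr := .seq (closure false) (closure true)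

theorem wf_closures : closures.WF := by
  simp [closures, closure, fill, round, alls, Prog.WF, Prog.bv, Formula.step, Fm.WF, Fm.bv,
    Formula.or, Formula.all, Formula.eq, Formula.adj, Formula.mem, Formula.rel, Formula.free]

theorem bv_closures : ∀ x ∈ closures.bv, x ≠ .one ∧ x ≠ .zero := by
  simp [closures, closure, fill, round, alls, Prog.bv, Formula.step, Fm.bv,
    Formula.or, Formula.all, Formula.eq, Formula.adj, Formula.mem, Formula.rel, Formula.free]

theorem wf_same : Formula.same.WF := by
  simp [Formula.same, Fm.WF, Fm.bv,
    Formula.or, Formula.all, Formula.mem, Formula.rel]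

theorem bv_same : ∀ x ∈ Formula.same.bv, x ≠ .one ∧ x ≠ .zero := by
  simp [Formula.same, Fm.bv,
    Formula.or, Formula.all, Formula.mem, Formula.rel]

/-! ### Induction principles for nested loops. -/

section Loops

variable {X M : Type} [DecidableEq X] [DecidableEq M] {n : ℕ} {c : Prog X M}

/-- Assignments that give values less than `n` to some variables. -/
def Assigns (n : ℕ) (e : X → ℕ) (xs : List X) (e' : X → ℕ) : Prop :=
  (∀ y, y ∉ xs → e' y = e y) ∧ ∀ y ∈ xs, e' y < n

theorem Assigns.cons {e e' : X → ℕ} {x : X} {xs : List X} {i : ℕ} (hi : i < n)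
    (h : Assigns n (Function.update e x i) xs e') : Assigns n e (x :: xs) e' := by
  constructor
  · intro y hy
    simp only [List.mem_cons, not_or] at hy
    rw [h.1 y hy.2, Function.update_of_ne hy.1]
  · intro y hy
    by_cases hy' : y ∈ xs
    · exact h.2 y hy'
    · obtain rfl : y = x := by simpa [hy'] using hy
      rw [h.1 y hy', Function.update_self]
      exact hi

theorem Assigns.tail {e e' : X → ℕ} {x : X} {xs : List X} (h : Assigns n e (x :: xs) e') :
    Assigns n (Function.update e x (e' x)) xs e' := by
  constructor
  · intro y hy
    by_cases hyx : y = x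
    · subst hyx
      simp
    · rw [Function.update_of_ne hyx]
      exact h.1 y (by simp [hyx, hy])
  · exact fun y hy => h.2 y (List.mem_cons_of_mem _ hy)

theorem foldl_range_induct {α : Type*} {f : α → ℕ → α} (P : ℕ → α → Prop) {m : ℕ} {x : α}
    (h0 : P 0 x) (h : ∀ i x, i < m → P i x → P (i + 1) (f x i)) :
    P m ((List.range m).foldl f x) := by
  induction m with
  | zero => exact h0
  | succ m ih =>
    rw [List.range_succ, List.foldl_append]
    exact h m _ (by omega) (ih fun i x hi => h i x (by omega))

/-- Counting the executions of the body of nested loops. -/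
theorem alls_induct (P : ℕ → (M → List Bool) → Prop) (xs : List X) {e : X → ℕ}
    (h : ∀ e', Assigns n e xs e' → ∀ k μ, P k μ → P (k + 1) (c.run n e' μ)) {k : ℕ}
    {μ : M → List Bool} (h0 : P k μ) : P (k + n ^ xs.length) ((alls xs c).run n e μ) := by
  induction xs generalizing e k μ with
  | nil => exact h e ⟨fun _ _ => rfl, by simp⟩ k μ h0
  | cons x xs ih =>
    have := foldl_range_induct (m := n) (x := μ)
      (f := fun μ i => (alls xs c).run n (Function.update e x i) μ)
      (fun i μ => P (k + i * n ^ xs.length) μ) (by simpa using h0) (fun i μ hi hP => by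
        have := ih (e := Function.update e x i) (fun e' he' => h e' (he'.cons hi)) hP
        rwa [add_assoc, ← Nat.succ_mul] at this)
    rw [List.length_cons, Nat.pow_succ']
    exact this

/-- Nested loops make the transitions of their bodies. -/
theorem alls_trans {T : (M → List Bool) → (M → List Bool) → Prop} (hrefl : ∀ μ, T μ μ)
    (htrans : ∀ μ ν ξ, T μ ν → T ν ξ → T μ ξ) (xs : List X) {e : X → ℕ}
    (h : ∀ e', Assigns n e xs e' → ∀ μ, T μ (c.run n e' μ)) (μ : M → List Bool) :
    T μ ((alls xs c).run n e μ) :=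
  alls_induct (fun _ ν => T μ ν) xs (fun e' he' _ ν hν => htrans _ _ _ hν (h e' he' ν))
    (k := 0) (hrefl μ)

/-- Nested loops run their body for all assignments. -/
theorem alls_hit {T : (M → List Bool) → (M → List Bool) → Prop} (hrefl : ∀ μ, T μ μ)
    (htrans : ∀ μ ν ξ, T μ ν → T ν ξ → T μ ξ) (xs : List X) {e : X → ℕ}
    (h : ∀ e', Assigns n e xs e' → ∀ μ, T μ (c.run n e' μ)) {e' : X → ℕ}
    (he' : Assigns n e xs e') (μ : M → List Bool) :
    ∃ ν, T μ ν ∧ T (c.run n e' ν) ((alls xs c).run n e μ) := by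
  induction xs generalizing e μ with
  | nil =>
    have : e' = e := funext fun y => he'.1 y (by simp)
    subst this
    exact ⟨μ, hrefl μ, hrefl _⟩
  | cons x xs ih =>
    have hx : e' x < n := he'.2 x (by simp)
    have hT : ∀ i < n, ∀ μ, T μ ((alls xs c).run n (Function.update e x i) μ) := fun i hi μ =>
      alls_trans hrefl htrans xs (fun e' he' => h e' (he'.cons hi)) μ
    -- Once the value `e' x` has been passed, the required execution of the body has occurred, and
    -- later iterations only append further transitions.
    refine foldl_range_induct (m := n) (x := μ)
      (f := fun μ i => (alls xs c).run n (Function.update e x i) μ)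
      (fun i ξ => T μ ξ ∧ (e' x < i → ∃ ν, T μ ν ∧ T (c.run n e' ν) ξ))
      ⟨hrefl μ, by simp⟩ (fun i ξ hi hP => ⟨htrans _ _ _ hP.1 (hT i hi ξ), fun hlt => ?_⟩) |>.2 hx
    rcases Nat.lt_succ_iff_lt_or_eq.1 hlt with hlt | rfl
    · obtain ⟨ν, h1, h2⟩ := hP.2 hlt
      exact ⟨ν, h1, htrans _ _ _ h2 (hT i hi ξ)⟩
    · obtain ⟨ν, h1, h2⟩ := ih (fun e' he' => h e' (he'.cons hi)) he'.tail ξ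
      exact ⟨ν, htrans _ _ _ hP.1 h1, h2⟩

theorem run_alls_grow (m : M) (xs : List X) (e : X → ℕ) (μ : M → List Bool) :
    (alls xs (.grow m)).run n e μ =
      Function.update μ m (List.replicate (n ^ xs.length) false ++ μ m) := by
  have := alls_induct (n := n) (c := .grow m) (e := e) (k := 0) (μ := μ)
    (fun k ν => ν = Function.update μ m (List.replicate k false ++ μ m)) xs
    (fun e' _ k ν hν => by
      subst hν
      simp [Prog.run, List.replicate_succ]) (by simp)
  simpa using this

end Loops

/-! ### The program computes the least closed relations. -/

section Correctness

variable {n : ℕ} {G : SimpleGraph (Fin n)} {S : Bool → Finset (Fin n)} {μ : Arr → List Bool}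

/-- The input array describes a graph and two sets of vertices. -/
structure InputOk (G : SimpleGraph (Fin n)) (S : Bool → Finset (Fin n)) (w : List Bool) : Prop where
  adj : ∀ u v : Fin n, w.getD (u * n + v) false = true ↔ G.Adj u v
  mem : ∀ (s : Bool) (v : Fin n), w.getD ((n + if s then 1 else 0) * n + v) false = true ↔ v ∈ S s

/-- The relation that is stored in an array. -/
def Stored (w : List Bool) (a v b x : Fin n) : Prop :=
  w.getD (((a * n + v) * n + b) * n + x) false = true

/-- The values of the constants. -/
def Consts (e : Var → ℕ) : Prop := e .one = 1 ∧ e .zero = 0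

variable {e : Var → ℕ}

theorem eval_adj (hw : InputOk G S (μ .inp)) {p q : Var} {u v : Fin n} (hu : e p = u)
    (hv : e q = v) : (Formula.adj p q).eval n μ e = true ↔ G.Adj u v := by
  rw [← hw.adj, Formula.adj, Formula.eval_bit]
  simp [address, hu, hv]

/-- The two characteristic vectors follow the `n` rows of the adjacency matrix as rows `n` and `n +
1`; in base `n`, bit `v` of the row `n + s` has the digits `1, s, v`. -/
theorem eval_mem (hw : InputOk G S (μ .inp)) (he : Consts e) {s : Bool} {p : Var} {v : Fin n}
    (hv : e p = v) : (Formula.mem s p).eval n μ e = true ↔ v ∈ S s := by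
  rw [← hw.mem, Formula.mem, Formula.eval_bit]
  cases s <;> simp [address, he.1, he.2, hv]

theorem eval_rel {s : Bool} {p q r t : Var} {a v b x : Fin n} (ha : e p = a) (hv : e q = v)
    (hb : e r = b) (hx : e t = x) :
    (Formula.rel s p q r t).eval n μ e = true ↔ Stored (μ (.rel s)) a v b x := by
  rw [Stored, Formula.rel, Formula.eval_bit]
  simp [address, ha, hv, hb, hx]

theorem eval_eq {p q : Var} {u v : Fin n} (hu : e p = u) (hv : e q = v) :
    (Formula.eq p q : Fm Var Arr).eval n μ e = true ↔ u = v := by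
  rw [Formula.eval_eq, hu, hv, Fin.ext_iff]

theorem eval_free (hw : InputOk G S (μ .inp)) {p q : Var} {u v : Fin n} (hu : e p = u)
    (hv : e q = v) : (Formula.free p q).eval n μ e = true ↔ Free G u v := by
  rw [Formula.free, Formula.eval_and, Formula.eval_not, Formula.eval_not, eval_eq hu hv,
    eval_adj hw hu hv, Free]

theorem Consts.update {p : Var} {i : ℕ} (he : Consts e) (h1 : p ≠ .one) (h0 : p ≠ .zero) :
    Consts (Function.update e p i) := by
  constructor
  · rw [Function.update_of_ne h1.symm, he.1]
  · rw [Function.update_of_ne h0.symm, he.2]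

theorem eval_step (hw : InputOk G S (μ .inp)) (he : Consts e) {s : Bool} {a v b x : Fin n}
    (ha : e .a = a) (hv : e .v = v) (hb : e .b = b) (hx : e .x = x) :
    (Formula.step s).eval n μ e = true ↔
      TokenStep G (S s) (Stored (μ (.rel s))) a v b x := by
  rw [Formula.step, Formula.eval_or, Formula.eval_or, Formula.eval_and, Formula.eval_and,
    Formula.eval_and, eval_mem hw he ha, eval_mem hw he hb, eval_eq hv ha, eval_eq hx hb,
    eval_rel hb hx ha hv, TokenStep, Formula.eval_ex]
  refine or_congr Iff.rfl (or_congr Iff.rfl (exists_congr fun u => ?_))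
  have hv' : Function.update e .u (u : ℕ) .v = v := by simpa using hv
  have ha' : Function.update e .u (u : ℕ) .a = a := by simpa using ha
  have hb' : Function.update e .u (u : ℕ) .b = b := by simpa using hb
  have hx' : Function.update e .u (u : ℕ) .x = x := by simpa using hx
  have hu' : Function.update e .u (u : ℕ) .u = u := by simp
  rw [Formula.eval_and, Formula.eval_and, Formula.eval_or, Formula.eval_and, Formula.eval_and,
    Formula.eval_and, Formula.eval_and, Formula.eval_not, eval_adj hw hu' hv', eval_eq ha' hb',
    eval_eq hx' hv', eval_rel ha' hu' ha' hu', eval_rel ha' hu' hb' hx', eval_free hw hx' hv',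
    Formula.eval_all]
  refine and_congr Iff.rfl (and_congr (forall_congr' fun c => ?_) Iff.rfl)
  have he' := (he.update (p := .u) (i := u) (by simp) (by simp)).update (p := .c) (i := c)
    (by simp) (by simp)
  rw [Formula.eval_or, Formula.eval_or, Formula.eval_not, eval_mem hw he' (v := c) (by simp),
    eval_eq (u := c) (v := a) (by simp) (by simpa using ha), Formula.eval_ex]
  rw [← imp_iff_not_or, ← or_iff_not_imp_left]
  refine imp_congr Iff.rfl (or_congr Iff.rfl (exists_congr fun y => ?_))
  rw [Formula.eval_and, eval_free hw (u := y) (v := v) (by simp) (by simpa using hv),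
    eval_rel (a := a) (v := u) (b := c) (x := y) (by simpa using ha) (by simp) (by simp) (by simp)]

theorem eval_same (hw : InputOk G S (μ .inp)) (he : Consts e) :
    Formula.same.eval n μ e = true ↔ ∀ a ∈ S false, ∃ b ∈ S true, ∀ u,
      Stored (μ (.rel false)) a u a u ↔ Stored (μ (.rel true)) b u b u := by
  rw [Formula.same, Formula.eval_all]
  refine forall_congr' fun a => ?_
  have ha := he.update (p := .a) (i := a) (by simp) (by simp)
  rw [Formula.eval_or, Formula.eval_not, eval_mem hw ha (v := a) (by simp), Formula.eval_ex,
    ← imp_iff_not_or]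
  refine imp_congr Iff.rfl (exists_congr fun b => ?_)
  have hb := ha.update (p := .b) (i := b) (by simp) (by simp)
  rw [Formula.eval_and, eval_mem hw hb (v := b) (by simp), Formula.eval_all]
  refine and_congr Iff.rfl (forall_congr' fun u => ?_)
  rw [Formula.eval_or, Formula.eval_and, Formula.eval_and, Formula.eval_not, Formula.eval_not,
    eval_rel (a := a) (v := u) (b := a) (x := u) (by simp) (by simp) (by simp) (by simp),
    eval_rel (a := b) (v := u) (b := b) (x := u) (by simp) (by simp) (by simp) (by simp)]
  tauto

theorem address_inj {a v b x a' v' b' x' : Fin n}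
    (h : (((a * n + v) * n + b) * n + x : ℕ) = ((a' * n + v') * n + b') * n + x') :
    a = a' ∧ v = v' ∧ b = b' ∧ x = x' := by
  have key : ∀ (p q : ℕ) (i j : Fin n), p * n + i = q * n + j → p = q ∧ i = j := by
    intro p q i j h
    have hn : 0 < n := i.pos
    have h1 : (p * n + i) % n = (q * n + j) % n := by rw [h]
    rw [Nat.mul_add_mod_self_right, Nat.mul_add_mod_self_right, Nat.mod_eq_of_lt i.2, Nat.mod_eq_of_lt j.2] at h1
    rw [h1] at h
    exact ⟨Nat.eq_of_mul_eq_mul_right hn (Nat.add_right_cancel h), Fin.ext h1⟩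
  obtain ⟨h, h4⟩ := key _ _ _ _ h
  obtain ⟨h, h3⟩ := key _ _ _ _ h
  obtain ⟨h, h2⟩ := key _ _ _ _ h
  exact ⟨Fin.ext h, h2, h3, h4⟩

theorem address_lt (a v b x : Fin n) : (((a * n + v) * n + b) * n + x : ℕ) < n ^ 4 := by
  have key : ∀ (p m : ℕ) (i : Fin n), p < m → p * n + i < m * n := by
    intro p m i h
    have := i.2
    nlinarith
  have := key _ _ x (key _ _ b (key _ _ v a.2))
  calc _ < _ := this
    _ = n ^ 4 := by ring

theorem stored_set {w : List Bool} (hw : w.length = n ^ 4) (a v b x a' v' b' x' : Fin n) :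
    Stored (w.set (((a * n + v) * n + b) * n + x) true) a' v' b' x' ↔
      Stored w a' v' b' x' ∨ (a = a' ∧ v = v' ∧ b = b' ∧ x = x') := by
  unfold Stored
  by_cases h : (((a * n + v) * n + b) * n + x : ℕ) = ((a' * n + v') * n + b') * n + x'
  · obtain ⟨rfl, rfl, rfl, rfl⟩ := address_inj h
    have := address_lt a v b x
    simp [List.getD_eq_getElem?_getD, hw, this]
  · have : ¬ (a = a' ∧ v = v' ∧ b = b' ∧ x = x') := by
      rintro ⟨rfl, rfl, rfl, rfl⟩
      exact h rfl
    simp [List.getD_eq_getElem?_getD, h, this]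

/-- The invariant of the computation of a relation. -/
structure Inv (n : ℕ) (s : Bool) (μ₀ μ : Arr → List Bool) : Prop where
  other : ∀ m, m ≠ .rel s → μ m = μ₀ m
  length : (μ (.rel s)).length = n ^ 4

/-- A transition that keeps the invariant, and adds only derivable facts to a relation. -/
def Derives (G : SimpleGraph (Fin n)) (S : Bool → Finset (Fin n)) (s : Bool)
    (μ₀ μ ν : Arr → List Bool) : Prop :=
  Inv n s μ₀ μ → Inv n s μ₀ ν ∧
    (∀ a v b x : Fin n, Stored (μ (.rel s)) a v b x → Stored (ν (.rel s)) a v b x) ∧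
    ∀ R, IsClosedRel G (S s) R → (∀ a v b x, Stored (μ (.rel s)) a v b x → R a v b x) →
      ∀ a v b x, Stored (ν (.rel s)) a v b x → R a v b x

variable {μ₀ : Arr → List Bool} {s : Bool}

theorem Derives.refl (μ : Arr → List Bool) : Derives G S s μ₀ μ μ :=
  fun h => ⟨h, fun _ _ _ _ h => h, fun _ _ h => h⟩

theorem Derives.trans (μ ν ξ : Arr → List Bool) (h : Derives G S s μ₀ μ ν)
    (h' : Derives G S s μ₀ ν ξ) : Derives G S s μ₀ μ ξ := by
  intro hμ
  obtain ⟨h1, h2, h3⟩ := h hμ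
  obtain ⟨h1', h2', h3'⟩ := h' h1
  exact ⟨h1', fun a v b x h => h2' _ _ _ _ (h2 _ _ _ _ h), fun R hR h => h3' R hR (h3 R hR h)⟩

/-- The body of the loops adds a derivable fact. -/
theorem run_setIf (hw : InputOk G S (μ₀ .inp)) (he : Consts e) {a v b x : Fin n}
    (ha : e .a = a) (hv : e .v = v) (hb : e .b = b) (hx : e .x = x) (hμ : Inv n s μ₀ μ) :
    Inv n s μ₀ ((Prog.setIf (Formula.step s) (.rel s) [.a, .v, .b, .x]).run n e μ) ∧
    ∀ a' v' b' x', Stored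
      ((Prog.setIf (Formula.step s) (.rel s) [.a, .v, .b, .x]).run n e μ (.rel s)) a' v' b' x' ↔
      Stored (μ (.rel s)) a' v' b' x' ∨ ((a = a' ∧ v = v' ∧ b = b' ∧ x = x') ∧
        TokenStep G (S s) (Stored (μ (.rel s))) a v b x) := by
  have hin : InputOk G S (μ .inp) := by rwa [hμ.other .inp (by simp)]
  have hstep := eval_step hin he (s := s) ha hv hb hx
  have haddr : address n e 0 [Var.a, .v, .b, .x] = ((a * n + v) * n + b) * n + x := by
    simp [address, ha, hv, hb, hx]
  simp only [Prog.run]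
  by_cases h : (Formula.step s).eval n μ e = true
  · rw [if_pos h, haddr]
    refine ⟨⟨fun m hm => by rw [Function.update_of_ne hm, hμ.other m hm], by simp [hμ.length]⟩,
      fun a' v' b' x' => ?_⟩
    rw [Function.update_self, stored_set hμ.length]
    simp [hstep.1 h]
  · rw [if_neg h]
    refine ⟨hμ, fun a' v' b' x' => ?_⟩
    simp [← hstep, h]

theorem derives_setIf (hw : InputOk G S (μ₀ .inp)) (he : Consts e) {a v b x : Fin n}
    (ha : e .a = a) (hv : e .v = v) (hb : e .b = b) (hx : e .x = x) (μ : Arr → List Bool) :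
    Derives G S s μ₀ μ
      ((Prog.setIf (Formula.step s) (.rel s) [.a, .v, .b, .x]).run n e μ) := by
  intro hμ
  obtain ⟨h1, h2⟩ := run_setIf hw he ha hv hb hx hμ
  refine ⟨h1, fun a' v' b' x' h => (h2 _ _ _ _).2 (.inl h), fun R hR h a' v' b' x' h' => ?_⟩
  rcases (h2 _ _ _ _).1 h' with h₁ | ⟨⟨rfl, rfl, rfl, rfl⟩, h₁⟩
  · exact h _ _ _ _ h₁
  · exact hR _ _ _ _ (h₁.mono h)

theorem Assigns.consts {xs : List Var} {e e' : Var → ℕ} (h : Assigns n e xs e') (he : Consts e)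
    (h1 : Var.one ∉ xs) (h0 : Var.zero ∉ xs) : Consts e' :=
  ⟨by rw [h.1 _ h1, he.1], by rw [h.1 _ h0, he.2]⟩

theorem derives_of_assigns (hw : InputOk G S (μ₀ .inp)) (he : Consts e) {e' : Var → ℕ}
    (h : Assigns n e [.a, .v, .b, .x] e') (μ : Arr → List Bool) :
    Derives G S s μ₀ μ
      ((Prog.setIf (Formula.step s) (.rel s) [.a, .v, .b, .x]).run n e' μ) :=
  derives_setIf hw (h.consts he (by simp) (by simp)) (a := ⟨_, h.2 .a (by simp)⟩)
    (v := ⟨_, h.2 .v (by simp)⟩) (b := ⟨_, h.2 .b (by simp)⟩) (x := ⟨_, h.2 .x (by simp)⟩)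
    rfl rfl rfl rfl μ

theorem derives_round (hw : InputOk G S (μ₀ .inp)) (he : Consts e) (μ : Arr → List Bool) :
    Derives G S s μ₀ μ ((round s).run n e μ) :=
  alls_trans Derives.refl Derives.trans _ (fun _ h => derives_of_assigns hw he h) μ

/-- A round adds all facts that can be derived in one step. -/
theorem stored_round (hw : InputOk G S (μ₀ .inp)) (he : Consts e) (hμ : Inv n s μ₀ μ)
    {a v b x : Fin n} (h : TokenStep G (S s) (Stored (μ (.rel s))) a v b x) :
    Stored ((round s).run n e μ (.rel s)) a v b x := by
  let e' : Var → ℕ := fun p => match p with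
    | .a => a
    | .v => v
    | .b => b
    | .x => x
    | p => e p
  have he' : Assigns n e [.a, .v, .b, .x] e' := by
    constructor
    · intro y hy
      cases y <;> simp_all [e']
    · intro y hy
      simp only [List.mem_cons, List.not_mem_nil, or_false] at hy
      rcases hy with rfl | rfl | rfl | rfl <;> simp [e']
  -- The array is updated in place, so the tuple is treated with an array `ν` that may already have
  -- grown; by monotonicity the step is still derivable from it.
  obtain ⟨ν, h1, h2⟩ := alls_hit (T := Derives G S s μ₀) Derives.refl Derives.trans _
    (fun _ h => derives_of_assigns (s := s) hw he h) he' μ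
  obtain ⟨hν, hsub, -⟩ := h1 hμ
  obtain ⟨h3, h4⟩ := run_setIf (a := a) (v := v) (b := b) (x := x) hw
    (he'.consts he (by simp) (by simp)) rfl rfl rfl rfl hν
  exact (h2 h3).2.1 _ _ _ _ ((h4 _ _ _ _).2 (.inr ⟨⟨rfl, rfl, rfl, rfl⟩, h.mono hsub⟩))

/-- The number of facts in an array. -/
noncomputable def numStored (n : ℕ) (w : List Bool) : ℕ :=
  {q : Fin n × Fin n × Fin n × Fin n | Stored w q.1 q.2.1 q.2.2.1 q.2.2.2}.ncard

/-- A round that starts from a relation that is not closed stores a new fact. So after `k` rounds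
the relation is closed or has at least `k` facts, and four idle loop variables give `n ^ 4` rounds.
Minimality holds because only derivable facts are added to the empty relation. -/
theorem isClosedRel_closure (hw : InputOk G S (μ .inp)) (he : Consts e) (hμ : μ (.rel s) = []) :
    (∀ m, m ≠ .rel s → (closure s).run n e μ m = μ m) ∧
    ((closure s).run n e μ (.rel s)).length = n ^ 4 ∧
    IsClosedRel G (S s) (Stored ((closure s).run n e μ (.rel s))) ∧
    ∀ R, IsClosedRel G (S s) R →
      ∀ a v b x, Stored ((closure s).run n e μ (.rel s)) a v b x → R a v b x := by
  let μ₁ := (fill s).run n e μ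
  have hμ₁ : μ₁ = Function.update μ (.rel s) (List.replicate (n ^ 4) false) := by
    simp [μ₁, fill, run_alls_grow, hμ]
  have hinv : Inv n s μ μ₁ := by
    rw [hμ₁]
    exact ⟨fun m hm => Function.update_of_ne hm _ _, by simp⟩
  have hempty : ∀ a v b x : Fin n, ¬ Stored (μ₁ (.rel s)) a v b x := by
    intro a v b x
    rw [hμ₁]
    simp [Stored, address_lt]
  have key := alls_induct (c := round s) (n := n) (e := e) (k := 0) (μ := μ₁)
    (fun k ν => Inv n s μ ν ∧
      (∀ R, IsClosedRel G (S s) R → ∀ a v b x, Stored (ν (.rel s)) a v b x → R a v b x) ∧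
      (IsClosedRel G (S s) (Stored (ν (.rel s))) ∨ k ≤ numStored n (ν (.rel s))))
    [.t₁, .t₂, .t₃, .t₄] (fun e' he' k ν hν => by
      obtain ⟨h1, h2, h3⟩ := hν
      have hc := he'.consts he (by simp) (by simp)
      obtain ⟨h1', h2', h3'⟩ := derives_round hw hc ν h1
      refine ⟨h1', fun R hR => h3' R hR (h2 R hR), ?_⟩
      by_cases hcl : IsClosedRel G (S s) (Stored (ν (.rel s)))
      · left
        intro a v b x h
        -- A closed relation bounds everything derived from itself, so the round adds nothing and
        -- closedness persists.
        exact h2' _ _ _ _ (hcl _ _ _ _ (h.mono (h3' _ hcl fun _ _ _ _ h => h)))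
      · right
        have h3 := h3.resolve_left hcl
        unfold IsClosedRel at hcl
        push Not at hcl
        obtain ⟨a, v, b, x, hs, hn⟩ := hcl
        refine lt_of_le_of_lt h3 (Set.ncard_lt_ncard ⟨fun q hq => h2' _ _ _ _ hq, fun hsub => ?_⟩)
        exact hn (hsub (show (a, v, b, x) ∈ _ from stored_round hw hc h1 hs)))
    ⟨hinv, fun R _ a v b x h => absurd h (hempty a v b x), .inr (Nat.zero_le _)⟩
  obtain ⟨h1, h2, h3⟩ := key
  refine ⟨h1.other, h1.length, ?_, h2⟩
  rcases h3 with h3 | h3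
  · exact h3
  -- With `n ^ 4` facts the relation holds for all tuples, hence is closed.
  · intro a v b x _
    have huniv : {q : Fin n × Fin n × Fin n × Fin n | Stored
        ((closure s).run n e μ (.rel s)) q.1 q.2.1 q.2.2.1 q.2.2.2} = Set.univ := by
      refine Set.eq_of_subset_of_ncard_le (Set.subset_univ _) ?_
      rw [Set.ncard_univ, Nat.card_prod, Nat.card_prod, Nat.card_prod, Nat.card_fin]
      refine le_trans (le_of_eq ?_) h3
      simp
      ring
    exact huniv.ge (Set.mem_univ (a, v, b, x))

end Correctness

/-! ### The encoding of instances and the complete decision program. -/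

open StackProgram.Cmd StackProgram.St

section Encoding

theorem getElem?_flatMap {α β : Type*} {n : ℕ} (g : α → List β) (hg : ∀ a, (g a).length = n)
    (l : List α) (i j : ℕ) (hj : j < n) :
    (l.flatMap g)[i * n + j]? = l[i]?.bind fun a => (g a)[j]? := by
  induction l generalizing i with
  | nil => simp
  | cons a l ih =>
    rw [List.flatMap_cons]
    cases i with
    | zero => rw [List.getElem?_append_left (by rw [hg]; omega)]; simp
    | succ i =>
      rw [List.getElem?_append_right (by rw [hg, Nat.succ_mul]; omega), hg]
      have : (i + 1) * n + j - n = i * n + j := by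
        rw [Nat.succ_mul]
        omega
      rw [this, ih]
      simp

theorem length_encodeSet {n : ℕ} (S : Finset (Fin n)) : (encodeSet S).length = n := by
  simp [encodeSet]

theorem length_encodeGraph {n : ℕ} (G : SimpleGraph (Fin n)) : (encodeGraph G).length = n * n := by
  simp [encodeGraph]

theorem getElem?_encodeSet {n : ℕ} (S : Finset (Fin n)) (v : Fin n) :
    (encodeSet S)[(v : ℕ)]? = some (decide (v ∈ S)) := by
  simp [encodeSet]

open Classical in
theorem getElem?_encodeGraph {n : ℕ} (G : SimpleGraph (Fin n)) (u v : Fin n) :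
    (encodeGraph G)[(u * n + v : ℕ)]? = some (decide (G.Adj u v)) := by
  rw [encodeGraph, getElem?_flatMap _ (by simp) _ _ _ v.2]
  simp

/-- The part of the encoding of an instance that follows the number of vertices. -/
noncomputable def tailCode (x : TSInstance) : List Bool :=
  encodeGraph x.G ++ encodeSet x.I.1 ++ encodeSet x.J.1

theorem encode_eq (x : TSInstance) :
    x.encode = List.replicate x.n true ++ false :: tailCode x := rfl

theorem inputOk_tailCode (x : TSInstance) :
    InputOk x.G (fun s => if s then x.J.1 else x.I.1) (tailCode x) := by
  classical
  constructor
  · intro u v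
    have hlt : (u * x.n + v : ℕ) < x.n * x.n := by
      have := u.2
      have := v.2
      nlinarith
    rw [tailCode, List.getD_eq_getElem?_getD, List.append_assoc,
      List.getElem?_append_left (by rwa [length_encodeGraph]), getElem?_encodeGraph]
    simp
  · intro s v
    have := v.2
    rw [tailCode, List.getD_eq_getElem?_getD]
    cases s
    · rw [List.getElem?_append_left (by simp [length_encodeSet, length_encodeGraph]),
        List.getElem?_append_right (by simp [length_encodeGraph]), length_encodeGraph]
      simp [getElem?_encodeSet]
    · rw [List.getElem?_append_right
        (by simp [length_encodeSet, length_encodeGraph, Nat.succ_mul])]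
      have : (x.n + if true then 1 else 0) * x.n + v -
          (encodeGraph x.G ++ encodeSet x.I.1).length = v := by
        simp [length_encodeSet, length_encodeGraph, Nat.succ_mul]
      rw [this, getElem?_encodeSet]
      simp

end Encoding

theorem polynomial_eval_mono (p : Polynomial ℕ) {m n : ℕ} (h : m ≤ n) : p.eval m ≤ p.eval n := by
  rw [Polynomial.eval_eq_sum, Polynomial.eval_eq_sum]
  exact Finset.sum_le_sum fun i _ => Nat.mul_le_mul_left _ (Nat.pow_le_pow_left h i)

/-- Read the number of vertices. -/
def readNum : Cmd (Key Var Arr) := .whileTrue (.mem .inp) (.push .num true)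

theorem runLe_readNum (m n : ℕ) (w : List Bool) (e γ : Var → ℕ) (μ : Arr → List Bool) :
    RunLe readNum (St.mk n 0 0 0 [] [] e γ
      (Function.update μ .inp (List.replicate m true ++ false :: w))).bits (m * 2 + 1)
      (St.mk (n + m) 0 0 0 [] [] e γ (Function.update μ .inp w)).bits := by
  induction m generalizing n with
  | zero =>
    have := (Run.while_false (k := .mem .inp) (c := .push .num true) (l := w)
      (s := (St.mk n 0 0 0 [] [] e γ (Function.update μ .inp (false :: w))).bits)
      (by simp [bits])).le le_rfl
    rw [update_mem, Function.update_idem] at this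
    exact this
  | succ m ih =>
    obtain ⟨t, ht, h⟩ := ih (n + 1)
    obtain ⟨t', ht', h'⟩ := push_num (n := n) (a := 0) (b := 0) (t := 0) (w := []) (z := []) (e := e)
      (γ := γ) (μ := Function.update μ .inp (List.replicate m true ++ false :: w))
    rw [show n + (m + 1) = n + 1 + m by omega]
    refine (Run.while_true (l := List.replicate m true ++ false :: w) (by simp [bits, List.replicate_succ])
      ?_ h).le (t := 1 + t' + t) (by omega)
    rw [update_mem, Function.update_idem]
    exact h'

/-- Empty the stacks that are in use at the end of the computation. -/
def cleanup : Cmd (Key Var Arr) :=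
  .seq (clear .num) (.seq (clear (.var .one)) (.seq (clear (.mem .inp))
    (.seq (clear (.mem (.rel false))) (clear (.mem (.rel true))))))

/-- The output convention of the machine demands that all stacks but the output stack be empty.
Among the variables only `one` is nonzero here. -/
theorem runLe_cleanup (n : ℕ) (z : List Bool) (μ : Arr → List Bool) :
    RunLe cleanup
      (St.mk n 0 0 0 [] z (Function.update (fun _ => 0) .one 1) (fun _ => 0) μ).bits
      (n * 2 + (μ .inp).length * 2 + (μ (.rel false)).length * 2 +
        (μ (.rel true)).length * 2 + 7)
      (Function.update (fun _ => []) .out z) := by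
  have := (runLe_clear .num
    (St.mk n 0 0 0 [] z (Function.update (fun _ => 0) Var.one 1) (fun _ => 0) μ).bits).seq
    ((runLe_clear (.var .one) _).seq ((runLe_clear (.mem .inp) _).seq
    ((runLe_clear (.mem (.rel false)) _).seq (runLe_clear (.mem (.rel true)) _))))
  have hfin : Function.update (Function.update (Function.update (Function.update (Function.update
      (St.mk n 0 0 0 [] z (Function.update (fun _ => 0) Var.one 1) (fun _ => 0) μ).bits
      .num []) (.var .one) []) (.mem .inp) []) (.mem (.rel false)) []) (.mem (.rel true)) [] =
      Function.update (fun _ => []) .out z := by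
    funext k
    cases k with
    | var y => cases y <;> simp [bits]
    | mem m =>
      cases m with
      | inp => simp
      | rel s => cases s <;> simp
    | _ => simp [bits]
  rw [hfin] at this
  refine this.mono ?_
  simp [bits]
  omega

/-- The program that decides whether two independent sets are in the same component. -/
def decideCmd : Cmd (Key Var Arr) :=
  .seq readNum (.seq (.push (.var .one) true)
    (.seq closures.cmd (.seq Formula.same.cmd cleanup)))

theorem runLe_decideCmd : ∃ p : Polynomial ℕ, ∀ (x : TSInstance) (f : Bool),
    (f = true ↔ x.SameComponent) → RunLe decideCmd (Function.update (fun _ => []) (.mem .inp) x.encode)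
      (p.eval x.encode.length) (Function.update (fun _ => []) .out [f]) := by
  obtain ⟨p, hp⟩ := closures.runLe_cmd wf_closures
  obtain ⟨q, hq⟩ := Formula.same.runLe_cmd wf_same
  -- The polynomials `p` and `q` pay for the closures and the final test. The other terms pay for
  -- reading `n`, setting the constant `one` and emptying the stacks, among them two arrays of
  -- length `n ^ 4`; `n` is at most the length of the input word.
  refine ⟨p + q + Polynomial.X ^ 4 * 4 + Polynomial.X * 6 + 9, fun x f hf => ?_⟩
  let μ₀ : Arr → List Bool := Function.update (fun _ => []) .inp (tailCode x)
  let e : Var → ℕ := Function.update (fun _ => 0) .one 1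
  have he : Consts e := ⟨by simp [e], by simp [e]⟩
  have hle : ∀ y, e y ≤ x.n + 1 := by
    intro y
    by_cases hy : y = .one
    · simp [e, hy]
    · simp [e, hy]
  have he0 : ∀ y, y ≠ .one → e y = 0 := fun y hy => by simp [e, hy]
  let μ₁ := (closure false).run x.n e μ₀
  let μ₂ := (closure true).run x.n e μ₁
  have hin := inputOk_tailCode x
  obtain ⟨h1, h2, h3, h4⟩ := isClosedRel_closure (μ := μ₀) (s := false) hin he rfl
  have hinp₁ : μ₁ .inp = tailCode x := h1 _ (by simp)
  obtain ⟨h1', h2', h3', h4'⟩ := isClosedRel_closure (μ := μ₁) (s := true) (by rwa [hinp₁]) he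
    (h1 _ (by simp))
  have hinp₂ : μ₂ .inp = tailCode x := (h1' _ (by simp)).trans hinp₁
  have hrel : μ₂ (.rel false) = μ₁ (.rel false) := h1' _ (by simp)
  have hval : Formula.same.eval x.n μ₂ e = f := by
    rw [Bool.eq_iff_iff, hf, eval_same (by rwa [hinp₂]) he, hrel, SameComponent,
      SimpleGraph.ConnectedComponent.eq]
    exact (reachable_iff x.interval x.I x.J h3 h4 h3' h4').symm
  have hinit : (Function.update (fun _ => []) (.mem .inp) x.encode : Key Var Arr → List Bool) =
      (St.mk 0 0 0 0 [] [] (fun _ => 0) (fun _ => 0) (Function.update (fun _ => []) .inp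
        (List.replicate x.n true ++ false :: tailCode x))).bits := by
    rw [← update_mem (μ := fun _ => []), ← encode_eq]
    congr 1
    funext k
    cases k <;> rfl
  rw [hinit]
  have r1 := runLe_readNum x.n 0 (tailCode x) (fun _ => 0) (fun _ => 0) (fun _ => [])
  have r2 := push_var (n := 0 + x.n) (a := 0) (b := 0) (t := 0) (w := []) (z := [])
    (e := fun _ => 0) (γ := fun _ => 0) (μ := μ₀) Var.one
  rw [Nat.zero_add] at r1 r2
  have r3 := hp x.n e (fun _ => 0) μ₀ [] hle fun y hy => ⟨he0 y (bv_closures y hy).1, rfl⟩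
  have r4 := hq x.n e (fun _ => 0) μ₂ [] hle fun y hy => ⟨he0 y (bv_same y hy).1, rfl⟩
  rw [hval] at r4
  have r5 := runLe_cleanup x.n [f] μ₂
  rw [hinp₂, hrel, h2, h2'] at r5
  refine (r1.seq (r2.seq (r3.seq (r4.seq r5)))).mono ?_
  have hlen : x.encode.length = x.n + 1 + (tailCode x).length := by
    rw [encode_eq]
    simp
    omega
  have hn : x.n ≤ x.encode.length := by omega
  have m1 := polynomial_eval_mono p hn
  have m2 := polynomial_eval_mono q hn
  have m3 := Nat.pow_le_pow_left hn 4
  simp only [Polynomial.eval_add, Polynomial.eval_mul, Polynomial.eval_pow, Polynomial.eval_X,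
    Polynomial.eval_ofNat]
  omega

end TokenSliding

theorem theorem3 :
    ∃ f : TSInstance → Bool, (∀ x : TSInstance, f x = true ↔ x.SameComponent) ∧
      Nonempty (Turing.TM2ComputableInPolyTime TSInstance.encode Computability.encodeBool f) := by
  classical
  obtain ⟨p, hp⟩ := TokenSliding.runLe_decideCmd
  -- The answer function may be chosen classically; the computational content lies in the machine
  -- that produces it.
  exact ⟨fun x => decide x.SameComponent, fun x => decide_eq_true_iff,
    StackProgram.Cmd.polyTime _ _ TokenSliding.decideCmd (.mem .inp) .out p
      fun x => hp x _ decide_eq_true_iff⟩
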